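/- Let $A\in\mathbb R^{n\times n}$, $B\in\mathbb R^{n\times m}$, let $Q\in\mathbb R^{n\times n}$, $R\in\mathbb R^{m\times m}$ be symmetric positive definite, and consider $x_{t+1}=Ax_t+\lambda_tBu_t$, $t\ge 0$, where $(\lambda_t)_{t\ge0}$ is an i.i.d. sequence with $\lambda_t=0$ with probability $q$ and $\lambda_t=1$ with probability $1-q$, $q\in(0,1)$, and $x_0$ is a random vector with finite second moments, independent of $(\lambda_t)_t$. The cost of a control sequence $\mathbf u=(u_t)_{t\ge 0}$ is $J(x_0,\mathbf u)=\mathbb E\big[\sum_{t\ge0}x_t^\top Qx_t+\lambda_tu_t^\top Ru_t\big]\in[0,\infty]$, and $J^*(x_0)$ is the least cost over all control sequences for which $u_t$ is a measurable function of $(x_0,\lambda_0,\dots,\lambda_{t-1})$ for every $t$. For $p\in[0,1]$ consider the modified Riccati equation $$P_p=Q+A^\top P_pA-(1-p)A^\top P_pB(R+B^\top P_pB)^{-1}B^\top P_pA,\qquad P_p\ \text{positive definite},$$ and let $q_c$ be the supremum of the $p\in[0,1]$ for which it has a solution. Assume $q<q_c$, let $P=P_q$ be the solution for $q$, and for $\hat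 q\in[0,q_c)$ let $\hat P=P_{\hat q}$ be the solution for $\hat q$, $\hat K=-(R+B^\top\hat PB)^{-1}B^\top\hat PA$, and $\hat{\mathbf u}=(\hat Kx_t)_{t\ge0}$. Then $J^*(x_0)<\infty$, and the following hold. (i) If $\hat K$ is mean-square stabilizing, that is, $\mathbb E[x_t^\top x_t]\to0$ under $u_t=\hat Kx_t$, then $J(x_0,\hat{\mathbf u})<\infty$ and $$J(x_0,\hat{\mathbf u})-J^*(x_0)=\operatorname{tr}\big\{(q-\hat q)X_{\hat K}+(\hat P-P)X_0\big\},$$ where $X_{\hat K}=A^\top\hat PB(R+B^\top\hat PB)^{-1}B^\top\hat PA\cdot\mathbb E\big[\sum_{t\ge0}x_tx_t^\top\big]$, with $x_t$ the state under $u_t=\hat Kx_t$, and $X_0=\mathbb E[x_0x_0^\top]$. Here $\mathbb E[\sum_{t\ge0}x_tx_t^\top]$ is well defined and finite, and the matrices $A^\top\hat PB(R+B^\top\hat PB)^{-1}B^\top\hat PA$, $\mathbb E[\sum_{t\ge0}x_tx_t^\top]$ and $X_0$ are positive semidefinite. (ii) As $\hat q\to q$, $\hat K$ is mean-square stabilizing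 with $J(x_0,\hat{\mathbf u})<\infty$ for all $\hat q$ sufficiently close to $q$, and $J(x_0,\hat{\mathbf u})-J^*(x_0)\to0$. -/

import Mathlib

open MeasureTheory ProbabilityTheory Filter Topology Matrix
open scoped ENNReal

noncomputable section

namespace PacketDropLQR

variable {n m : ℕ} {Ω : Type*}

/-- The modified Riccati equation with drop probability `p`,
`P = Q + Aᵀ P A - (1 - p) Aᵀ P B (R + Bᵀ P B)⁻¹ Bᵀ P A`, for a positive definite `P`. -/
structure IsRiccatiSolution (A : Matrix (Fin n) (Fin n) ℝ) (B : Matrix (Fin n) (Fin m) ℝ)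
    (Q : Matrix (Fin n) (Fin n) ℝ) (R : Matrix (Fin m) (Fin m) ℝ) (p : ℝ)
    (P : Matrix (Fin n) (Fin n) ℝ) : Prop where
  posDef : P.PosDef
  eq : P = Q + Aᵀ * P * A
    - (1 - p) • (Aᵀ * P * B * (R + Bᵀ * P * B)⁻¹ * Bᵀ * P * A)

/-- The critical drop probability `q_c`: the supremum of the probabilities for which the modified
Riccati equation has a positive definite solution. -/
def criticalProb (A : Matrix (Fin n) (Fin n) ℝ) (B : Matrix (Fin n) (Fin m) ℝ)
    (Q : Matrix (Fin n) (Fin n) ℝ) (R : Matrix (Fin m) (Fin m) ℝ) : ℝ :=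
  sSup {p : ℝ | p ∈ Set.Icc (0 : ℝ) 1 ∧ ∃ P, IsRiccatiSolution A B Q R p P}

/-- The gain `K = -(R + Bᵀ P B)⁻¹ Bᵀ P A`. -/
def gain (A : Matrix (Fin n) (Fin n) ℝ) (B : Matrix (Fin n) (Fin m) ℝ)
    (R : Matrix (Fin m) (Fin m) ℝ) (P : Matrix (Fin n) (Fin n) ℝ) : Matrix (Fin m) (Fin n) ℝ :=
  -((R + Bᵀ * P * B)⁻¹ * Bᵀ * P * A)

/-- `lam` is an i.i.d. sequence with `lam t = 0` with probability `q` (the packet is lost) and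
`lam t = 1` with probability `1 - q` (the packet arrives). -/
structure IsDropSequence [MeasurableSpace Ω] (μ : Measure Ω) (q : ℝ) (lam : ℕ → Ω → ℝ) : Prop where
  measurable : ∀ t, Measurable (lam t)
  indep : iIndepFun lam μ
  drop : ∀ t, μ {ω | lam t ω = 0} = ENNReal.ofReal q
  arrive : ∀ t, μ {ω | lam t ω = 1} = ENNReal.ofReal (1 - q)

/-- The state of `x (t + 1) = A x t + lam t B u t` under the control sequence `u`. -/
def state (A : Matrix (Fin n) (Fin n) ℝ) (B : Matrix (Fin n) (Fin m) ℝ)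
    (x₀ : Ω → Fin n → ℝ) (lam : ℕ → Ω → ℝ) (u : ℕ → Ω → Fin m → ℝ) : ℕ → Ω → Fin n → ℝ
  | 0, ω => x₀ ω
  | t + 1, ω => A *ᵥ state A B x₀ lam u t ω + lam t ω • (B *ᵥ u t ω)

/-- The closed-loop state under the feedback `u t = K x t`. -/
def feedbackState (A : Matrix (Fin n) (Fin n) ℝ) (B : Matrix (Fin n) (Fin m) ℝ)
    (x₀ : Ω → Fin n → ℝ) (lam : ℕ → Ω → ℝ) (K : Matrix (Fin m) (Fin n) ℝ) : ℕ → Ω → Fin n → ℝ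
  | 0, ω => x₀ ω
  | t + 1, ω => A *ᵥ feedbackState A B x₀ lam K t ω
      + lam t ω • (B *ᵥ (K *ᵥ feedbackState A B x₀ lam K t ω))

/-- The control sequence generated by the feedback `u t = K x t`. -/
def feedbackControl (A : Matrix (Fin n) (Fin n) ℝ) (B : Matrix (Fin n) (Fin m) ℝ)
    (x₀ : Ω → Fin n → ℝ) (lam : ℕ → Ω → ℝ) (K : Matrix (Fin m) (Fin n) ℝ) : ℕ → Ω → Fin m → ℝ :=
  fun t ω => K *ᵥ feedbackState A B x₀ lam K t ω

theorem state_feedbackControl (A : Matrix (Fin n) (Fin n) ℝ) (B : Matrix (Fin n) (Fin m) ℝ)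
    (x₀ : Ω → Fin n → ℝ) (lam : ℕ → Ω → ℝ) (K : Matrix (Fin m) (Fin n) ℝ) (t : ℕ) (ω : Ω) :
    state A B x₀ lam (feedbackControl A B x₀ lam K) t ω = feedbackState A B x₀ lam K t ω := by
  induction t with
  | zero => rfl
  | succ t ih => simp only [state, feedbackState, ih, feedbackControl]

/-- The information available to the controller at time `t`: the initial state and the outcomes of
the transmissions before time `t` (equivalently, also all states up to time `t`). -/
abbrev info (x₀ : Ω → Fin n → ℝ) (lam : ℕ → Ω → ℝ) (t : ℕ) : MeasurableSpace Ω :=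
  MeasurableSpace.comap x₀ inferInstance ⊔
    ⨆ s : ℕ, ⨆ _ : s < t, MeasurableSpace.comap (lam s) inferInstance

/-- Admissible control sequences: `u t` depends only on the information available at time `t`. -/
def Admissible (x₀ : Ω → Fin n → ℝ) (lam : ℕ → Ω → ℝ) (u : ℕ → Ω → Fin m → ℝ) : Prop :=
  ∀ t, Measurable[info x₀ lam t] (u t)

variable [MeasurableSpace Ω]

/-- The cost `J(x₀, u) = E [∑ t, xₜᵀ Q xₜ + lam t uₜᵀ R uₜ]`, with values in `[0, ∞]`. -/
def cost (μ : Measure Ω) (A : Matrix (Fin n) (Fin n) ℝ) (B : Matrix (Fin n) (Fin m) ℝ)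
    (Q : Matrix (Fin n) (Fin n) ℝ) (R : Matrix (Fin m) (Fin m) ℝ)
    (x₀ : Ω → Fin n → ℝ) (lam : ℕ → Ω → ℝ) (u : ℕ → Ω → Fin m → ℝ) : ℝ≥0∞ :=
  ∫⁻ ω, ∑' t, ENNReal.ofReal
    (state A B x₀ lam u t ω ⬝ᵥ (Q *ᵥ state A B x₀ lam u t ω)
      + lam t ω * (u t ω ⬝ᵥ (R *ᵥ u t ω))) ∂μ

/-- The optimal cost `J*(x₀)`, the least cost over all admissible control sequences. -/
def optimalCost (μ : Measure Ω) (A : Matrix (Fin n) (Fin n) ℝ) (B : Matrix (Fin n) (Fin m) ℝ)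
    (Q : Matrix (Fin n) (Fin n) ℝ) (R : Matrix (Fin m) (Fin m) ℝ)
    (x₀ : Ω → Fin n → ℝ) (lam : ℕ → Ω → ℝ) : ℝ≥0∞ :=
  ⨅ u : ℕ → Ω → Fin m → ℝ, ⨅ _ : Admissible x₀ lam u, cost μ A B Q R x₀ lam u

/-- `K` mean-square stabilizes the system: `E [xₜᵀ xₜ] → 0` under the feedback `u t = K x t`. -/
def MeanSquareStabilizes (μ : Measure Ω) (A : Matrix (Fin n) (Fin n) ℝ)
    (B : Matrix (Fin n) (Fin m) ℝ) (x₀ : Ω → Fin n → ℝ) (lam : ℕ → Ω → ℝ)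
    (K : Matrix (Fin m) (Fin n) ℝ) : Prop :=
  Tendsto (fun t => ∫⁻ ω, ENNReal.ofReal
    (feedbackState A B x₀ lam K t ω ⬝ᵥ feedbackState A B x₀ lam K t ω) ∂μ) atTop (𝓝 0)

/-- The matrix `X₀ = E [x₀ x₀ᵀ]`. -/
def initialMoment (μ : Measure Ω) (x₀ : Ω → Fin n → ℝ) : Matrix (Fin n) (Fin n) ℝ :=
  Matrix.of fun i j => ∫ ω, x₀ ω i * x₀ ω j ∂μ

/-- The matrix `E [∑ t, xₜ xₜᵀ]` along the closed loop with gain `K`. -/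
def momentSum (μ : Measure Ω) (A : Matrix (Fin n) (Fin n) ℝ) (B : Matrix (Fin n) (Fin m) ℝ)
    (x₀ : Ω → Fin n → ℝ) (lam : ℕ → Ω → ℝ) (K : Matrix (Fin m) (Fin n) ℝ) :
    Matrix (Fin n) (Fin n) ℝ :=
  Matrix.of fun i j =>
    ∫ ω, ∑' t, feedbackState A B x₀ lam K t ω i * feedbackState A B x₀ lam K t ω j ∂μ

/-- The entries of `E [∑ t, xₜ xₜᵀ]` are well defined and finite. -/
def MomentSumFinite (μ : Measure Ω) (A : Matrix (Fin n) (Fin n) ℝ) (B : Matrix (Fin n) (Fin m) ℝ)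
    (x₀ : Ω → Fin n → ℝ) (lam : ℕ → Ω → ℝ) (K : Matrix (Fin m) (Fin n) ℝ) : Prop :=
  ∀ i j,
    (∀ᵐ ω ∂μ, Summable fun t =>
      feedbackState A B x₀ lam K t ω i * feedbackState A B x₀ lam K t ω j) ∧
    Integrable (fun ω => ∑' t,
      feedbackState A B x₀ lam K t ω i * feedbackState A B x₀ lam K t ω j) μ

/-- The matrix `Aᵀ P B (R + Bᵀ P B)⁻¹ Bᵀ P A`. -/
def gapWeight (A : Matrix (Fin n) (Fin n) ℝ) (B : Matrix (Fin n) (Fin m) ℝ)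
    (R : Matrix (Fin m) (Fin m) ℝ) (P : Matrix (Fin n) (Fin n) ℝ) : Matrix (Fin n) (Fin n) ℝ :=
  Aᵀ * P * B * (R + Bᵀ * P * B)⁻¹ * Bᵀ * P * A

end PacketDropLQR

end

open PacketDropLQR

/-! For a matrix `Y`, a state `x` and a control `u`, let `stepValue` be the expected stage cost plus
the expected value of `Y` at the next state. Completing the square in `u` shows that a Riccati
solution `P` for the probability `p`, used in a system with probability `q`, satisfies `stepValue q
P x u = xᵀPx + (q - p) xᵀWx + (1 - q) · square`. Here `W` is `gapWeight` and the square vanishes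
exactly at the certainty-equivalent control (`IsRiccatiSolution.stepValue_eq`). Everything rests on
this identity.

For `p = q` it says that `P` is a lower bound for one step, attained by its own gain. Telescoping,
with terminal terms that vanish along every control of finite cost, gives the optimal cost
`E[x₀ᵀPx₀]` (`IsDropSequence.optimalCost_eq`). For `p ≠ q` and `u = K̂x`, the stage costs telescope
up to the terms `(q - p) tr(W Mₜ)`, where `Mₜ` is the second moment of the state. Summation gives
the gap formula (`IsDropSequence.cost_gain`). The sum of the `Mₜ` converges because they are
iterates of a linear map on a finite-dimensional space and tend to zero
(`exists_tendsto_sum_pow_apply`).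

The limit needs no continuity of `p ↦ P_p`. If one step raises a value `Y` by at most `εQ`, then
`Y/(1 - ε)` is not raised at all (`stepValue_smul_le_of_le`). Such a value dominates the Riccati
solution (`IsRiccatiSolution.quad_le_of_stepValue_le`) and bounds the cost of the feedback
(`IsDropSequence.cost_feedback_le`). Applied once to `P` with probability `p` and once to `P_p` with
probability `q`, this squeezes the cost between the optimal cost and `(1 - 2|p - q|c)⁻¹` times it
(`IsDropSequence.cost_gain_le`). -/

namespace PacketDropLQR

/-! ### Quadratic forms and their comparison. -/

section QuadraticForms

variable {n m : ℕ}

/-- The quadratic form `x ↦ xᵀ M x`. -/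
def quad (M : Matrix (Fin n) (Fin n) ℝ) (x : Fin n → ℝ) : ℝ := x ⬝ᵥ (M *ᵥ x)

theorem quad_add_matrix (M N : Matrix (Fin n) (Fin n) ℝ) (x : Fin n → ℝ) :
    quad (M + N) x = quad M x + quad N x := by
  simp [quad, add_mulVec]

theorem quad_sub_matrix (M N : Matrix (Fin n) (Fin n) ℝ) (x : Fin n → ℝ) :
    quad (M - N) x = quad M x - quad N x := by
  simp [quad, sub_mulVec]

theorem quad_smul_matrix (c : ℝ) (M : Matrix (Fin n) (Fin n) ℝ) (x : Fin n → ℝ) :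
    quad (c • M) x = c * quad M x := by
  simp [quad, smul_mulVec]

theorem quad_smul (c : ℝ) (M : Matrix (Fin n) (Fin n) ℝ) (x : Fin n → ℝ) :
    quad M (c • x) = c ^ 2 * quad M x := by
  simp [quad, mulVec_smul]; ring

theorem quad_transpose_mul_mul (M : Matrix (Fin n) (Fin n) ℝ) (C : Matrix (Fin n) (Fin m) ℝ)
    (x : Fin m → ℝ) : quad (Cᵀ * M * C) x = quad M (C *ᵥ x) := by
  simp only [quad, ← mulVec_mulVec]
  rw [dotProduct_mulVec, vecMul_transpose]

theorem dotProduct_mulVec_comm_of_symm {M : Matrix (Fin n) (Fin n) ℝ} (hM : Mᵀ = M)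
    (x y : Fin n → ℝ) : x ⬝ᵥ (M *ᵥ y) = y ⬝ᵥ (M *ᵥ x) := by
  rw [dotProduct_mulVec, ← mulVec_transpose, hM, dotProduct_comm]

theorem quad_add {M : Matrix (Fin n) (Fin n) ℝ} (hM : Mᵀ = M) (x y : Fin n → ℝ) :
    quad M (x + y) = quad M x + 2 * (x ⬝ᵥ (M *ᵥ y)) + quad M y := by
  simp only [quad, mulVec_add, dotProduct_add, add_dotProduct]
  rw [dotProduct_mulVec_comm_of_symm hM y x]
  ring

theorem quad_nonneg {M : Matrix (Fin n) (Fin n) ℝ} (hM : M.PosSemidef) (x : Fin n → ℝ) :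
    0 ≤ quad M x := by
  simpa [quad] using hM.dotProduct_mulVec_nonneg x

theorem transpose_eq_of_posDef {M : Matrix (Fin n) (Fin n) ℝ} (hM : M.PosDef) : Mᵀ = M := by
  simpa using hM.isHermitian.eq

theorem continuous_quad (M : Matrix (Fin n) (Fin n) ℝ) : Continuous (quad M) := by
  unfold quad
  fun_prop

theorem measurable_quad (M : Matrix (Fin n) (Fin n) ℝ) : Measurable (quad M) :=
  (continuous_quad M).measurable

/-- Every quadratic form is dominated by a multiple of a positive definite one. -/
theorem exists_quad_le_mul_quad {M : Matrix (Fin n) (Fin n) ℝ} (hM : M.PosDef)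
    (N : Matrix (Fin n) (Fin n) ℝ) : ∃ c : ℝ, 0 < c ∧ ∀ x, quad N x ≤ c * quad M x := by
  have hpos : ∀ x ∈ Metric.sphere (0 : Fin n → ℝ) 1, 0 < quad M x := fun x hx => by
    have : x ≠ 0 := by rintro rfl; simp at hx
    simpa [quad] using hM.dotProduct_mulVec_pos this
  -- The ratio of two quadratic forms is invariant under scaling, so its bound on the compact unit
  -- sphere holds everywhere.
  have hcont : ContinuousOn (fun x => quad N x / quad M x) (Metric.sphere (0 : Fin n → ℝ) 1) :=
    (continuous_quad N).continuousOn.div (continuous_quad M).continuousOn fun x hx => (hpos x hx).ne'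
  obtain ⟨C, hC⟩ := (isCompact_sphere (0 : Fin n → ℝ) 1).bddAbove_image hcont
  -- The maximum with `1` only serves to make the constant positive.
  refine ⟨max C 1, by positivity, fun x => ?_⟩
  rcases eq_or_ne x 0 with rfl | hx
  · simp [quad]
  have hnx : ‖x‖ ≠ 0 := norm_ne_zero_iff.2 hx
  have hy : ‖x‖⁻¹ • x ∈ Metric.sphere (0 : Fin n → ℝ) 1 := by
    simp [norm_smul, hnx]
  have h1 : quad N (‖x‖⁻¹ • x) / quad M (‖x‖⁻¹ • x) ≤ C := hC ⟨_, hy, rfl⟩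
  rw [quad_smul, quad_smul, mul_div_mul_left _ _ (by positivity)] at h1
  have hMx : 0 < quad M x := by simpa [quad] using hM.dotProduct_mulVec_pos hx
  rw [div_le_iff₀ hMx] at h1
  exact h1.trans (mul_le_mul_of_nonneg_right (le_max_left _ _) hMx.le)

theorem quad_add_inv_mulVec {S : Matrix (Fin m) (Fin m) ℝ} (hS : S.PosDef) (u b : Fin m → ℝ) :
    quad S (u + S⁻¹ *ᵥ b) = quad S u + 2 * (u ⬝ᵥ b) + quad S⁻¹ b := by
  have hu : IsUnit S.det := (isUnit_iff_isUnit_det S).1 hS.isUnit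
  have hb : S *ᵥ (S⁻¹ *ᵥ b) = b := by rw [mulVec_mulVec, mul_nonsing_inv S hu, one_mulVec]
  rw [quad_add (transpose_eq_of_posDef hS), hb]
  congr 1
  rw [quad, hb, quad, dotProduct_comm]

end QuadraticForms

/-! ### The Riccati equation as a one-step optimality identity. -/

section Riccati

variable {n m : ℕ} {A : Matrix (Fin n) (Fin n) ℝ} {B : Matrix (Fin n) (Fin m) ℝ}
  {Q : Matrix (Fin n) (Fin n) ℝ} {R : Matrix (Fin m) (Fin m) ℝ}

theorem posDef_add_transpose_mul_mul (hR : R.PosDef) {P : Matrix (Fin n) (Fin n) ℝ}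
    (hP : P.PosSemidef) : (R + Bᵀ * P * B).PosDef := by
  have := hP.conjTranspose_mul_mul_same B
  rw [conjTranspose_eq_transpose_of_trivial] at this
  exact hR.add_posSemidef this

/-- Symmetry of `P` turns the matrix into a congruence of the inverse of a positive definite matrix,
from which semidefiniteness can be read off. -/
theorem gapWeight_eq {P : Matrix (Fin n) (Fin n) ℝ} (hP : P.PosDef) :
    gapWeight A B R P = (Bᵀ * P * A)ᵀ * (R + Bᵀ * P * B)⁻¹ * (Bᵀ * P * A) := by
  simp only [gapWeight, transpose_mul, transpose_transpose, transpose_eq_of_posDef hP,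
    Matrix.mul_assoc]

theorem posSemidef_gapWeight (hR : R.PosDef) {P : Matrix (Fin n) (Fin n) ℝ} (hP : P.PosDef) :
    (gapWeight A B R P).PosSemidef := by
  rw [gapWeight_eq hP, ← conjTranspose_eq_transpose_of_trivial]
  exact (posDef_add_transpose_mul_mul hR hP.posSemidef).inv.posSemidef.conjTranspose_mul_mul_same _

/-- Completion of the square in the control variable. -/
theorem quad_control_add_quad_next (hR : R.PosDef) {P : Matrix (Fin n) (Fin n) ℝ} (hP : P.PosDef)
    (x : Fin n → ℝ) (u : Fin m → ℝ) :
    quad R u + quad P (A *ᵥ x + B *ᵥ u) = quad P (A *ᵥ x) - quad (gapWeight A B R P) x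
      + quad (R + Bᵀ * P * B) (u - gain A B R P *ᵥ x) := by
  have hS := posDef_add_transpose_mul_mul (B := B) hR hP.posSemidef
  have hg : u - gain A B R P *ᵥ x = u + (R + Bᵀ * P * B)⁻¹ *ᵥ ((Bᵀ * P * A) *ᵥ x) := by
    rw [gain, neg_mulVec, sub_neg_eq_add, mulVec_mulVec]
    simp only [Matrix.mul_assoc]
  have hcross : u ⬝ᵥ ((Bᵀ * P * A) *ᵥ x) = (A *ᵥ x) ⬝ᵥ (P *ᵥ (B *ᵥ u)) := by
    rw [dotProduct_mulVec_comm_of_symm (transpose_eq_of_posDef hP)]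
    simp only [← mulVec_mulVec]
    rw [dotProduct_mulVec, vecMul_transpose]
  rw [hg, quad_add_inv_mulVec hS, gapWeight_eq hP, quad_transpose_mul_mul, quad_add_matrix,
    quad_transpose_mul_mul, hcross, quad_add (transpose_eq_of_posDef hP)]
  ring

/-- At the control that annihilates the completed square, the left side of the square identity is
still nonnegative. -/
theorem quad_gapWeight_le (hR : R.PosDef) {P : Matrix (Fin n) (Fin n) ℝ} (hP : P.PosDef)
    (x : Fin n → ℝ) : quad (gapWeight A B R P) x ≤ quad P (A *ᵥ x) := by
  have h := quad_control_add_quad_next (A := A) (B := B) hR hP x (gain A B R P *ᵥ x)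
  have h1 := quad_nonneg hR.posSemidef (gain A B R P *ᵥ x)
  have h2 := quad_nonneg hP.posSemidef (A *ᵥ x + B *ᵥ (gain A B R P *ᵥ x))
  have h3 : quad (R + Bᵀ * P * B) (gain A B R P *ᵥ x - gain A B R P *ᵥ x) = 0 := by simp [quad]
  linarith

variable (A B Q R) in
/-- The expected stage cost plus the expected value, under the quadratic value `Y`, of the next
state, from the state `x` under the control `u`, with drop probability `p`. -/
def stepValue (p : ℝ) (Y : Matrix (Fin n) (Fin n) ℝ) (x : Fin n → ℝ) (u : Fin m → ℝ) : ℝ :=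
  quad Q x + (1 - p) * quad R u + p * quad Y (A *ᵥ x) + (1 - p) * quad Y (A *ᵥ x + B *ᵥ u)

/-- The completed square contributes `-(1 - q)W`, while the equation for `P` contains `-(1 - p)W`;
the mismatch of the two probabilities is what remains. -/
theorem IsRiccatiSolution.stepValue_eq (hR : R.PosDef) {p : ℝ} {P : Matrix (Fin n) (Fin n) ℝ}
    (hP : IsRiccatiSolution A B Q R p P) (q : ℝ) (x : Fin n → ℝ) (u : Fin m → ℝ) :
    stepValue A B Q R q P x u = quad P x + (q - p) * quad (gapWeight A B R P) x
      + (1 - q) * quad (R + Bᵀ * P * B) (u - gain A B R P *ᵥ x) := by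
  have h := quad_control_add_quad_next (A := A) (B := B) hR hP.posDef x u
  have h2 : quad P x = quad Q x + quad P (A *ᵥ x) - (1 - p) * quad (gapWeight A B R P) x := by
    conv_lhs => rw [hP.eq]
    rw [quad_sub_matrix, quad_add_matrix, quad_smul_matrix, quad_transpose_mul_mul, gapWeight]
  rw [stepValue, h2]
  linear_combination (1 - q) * h

theorem IsRiccatiSolution.stepValue_gain_eq (hR : R.PosDef) {p : ℝ}
    {P : Matrix (Fin n) (Fin n) ℝ} (hP : IsRiccatiSolution A B Q R p P) (q : ℝ) (x : Fin n → ℝ) :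
    stepValue A B Q R q P x (gain A B R P *ᵥ x)
      = quad P x + (q - p) * quad (gapWeight A B R P) x := by
  rw [hP.stepValue_eq hR, sub_self]
  simp [quad]

theorem IsRiccatiSolution.quad_le_stepValue (hR : R.PosDef) {p : ℝ} (hp : p ≤ 1)
    {P : Matrix (Fin n) (Fin n) ℝ} (hP : IsRiccatiSolution A B Q R p P) (x : Fin n → ℝ)
    (u : Fin m → ℝ) : quad P x ≤ stepValue A B Q R p P x u := by
  rw [hP.stepValue_eq hR, sub_self, zero_mul, add_zero]
  exact le_add_of_nonneg_right (mul_nonneg (by linarith) (quad_nonneg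
    (posDef_add_transpose_mul_mul hR hP.posDef.posSemidef).posSemidef _))

/-- Enlarging the value by the factor `(1 - ε)⁻¹` makes the stage cost relatively cheaper. After
multiplication by `1 - ε`, the stage cost has lost an `ε`-fraction, which contains `εQ` and so pays
for the allowed increase. -/
theorem stepValue_smul_le_of_le (hR : R.PosDef) {p ε : ℝ} (hp : p ≤ 1)
    (hε0 : 0 ≤ ε) (hε1 : ε < 1) {Y : Matrix (Fin n) (Fin n) ℝ} {K : Matrix (Fin m) (Fin n) ℝ}
    (h : ∀ x, stepValue A B Q R p Y x (K *ᵥ x) ≤ quad Y x + ε * quad Q x) (x : Fin n → ℝ) :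
    stepValue A B Q R p ((1 - ε)⁻¹ • Y) x (K *ᵥ x) ≤ quad ((1 - ε)⁻¹ • Y) x := by
  have hx := h x
  have h1 : 0 < 1 - ε := by linarith
  have h2 : 0 ≤ (1 - p) * quad R (K *ᵥ x) :=
    mul_nonneg (by linarith) (quad_nonneg hR.posSemidef _)
  refine le_of_mul_le_mul_left ?_ h1
  simp only [stepValue, quad_smul_matrix] at hx ⊢
  have h3 : ∀ z : ℝ, (1 - ε) * ((1 - ε)⁻¹ * z) = z := fun z => by field_simp
  have h4 : (1 - ε) * (quad Q x + (1 - p) * quad R (K *ᵥ x)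
      + p * ((1 - ε)⁻¹ * quad Y (A *ᵥ x))
      + (1 - p) * ((1 - ε)⁻¹ * quad Y (A *ᵥ x + B *ᵥ (K *ᵥ x))))
      = (1 - ε) * (quad Q x + (1 - p) * quad R (K *ᵥ x)) + p * quad Y (A *ᵥ x)
      + (1 - p) * quad Y (A *ᵥ x + B *ᵥ (K *ᵥ x)) := by
    field_simp
  rw [h4, h3]
  nlinarith [mul_nonneg hε0 h2]

/-- A solution of the Riccati equation lies below every value that the closed loop of some linear
feedback does not increase. -/
theorem IsRiccatiSolution.quad_le_of_stepValue_le (hR : R.PosDef) (hQ : Q.PosDef) {p : ℝ}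
    (hp : p ∈ Set.Icc (0 : ℝ) 1) {P : Matrix (Fin n) (Fin n) ℝ}
    (hP : IsRiccatiSolution A B Q R p P) {Y : Matrix (Fin n) (Fin n) ℝ} (hY : Y.PosDef)
    {K : Matrix (Fin m) (Fin n) ℝ} (h : ∀ x, stepValue A B Q R p Y x (K *ᵥ x) ≤ quad Y x)
    (x : Fin n → ℝ) : quad P x ≤ quad Y x := by
  obtain ⟨C, hC, hPC⟩ := exists_quad_le_mul_quad hY P
  obtain ⟨D, hD, hYD⟩ := exists_quad_le_mul_quad hQ Y
  have hY0 := fun x => quad_nonneg hY.posSemidef x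
  have hQ0 := fun x => quad_nonneg hQ.posSemidef x
  set r : ℝ := 1 - (max D 1)⁻¹ with hr
  have hD1 : 1 ≤ max D 1 := le_max_right _ _
  have hr0 : 0 ≤ r := by
    rw [hr]; linarith [inv_le_one_of_one_le₀ hD1]
  have hr1 : r < 1 := by
    have : 0 < (max D 1)⁻¹ := by positivity
    linarith
  have hQY : ∀ x, (1 - r) * quad Y x ≤ quad Q x := fun x => by
    rw [hr, sub_sub_cancel, inv_mul_le_iff₀ (by positivity)]
    exact (hYD x).trans (mul_le_mul_of_nonneg_right (le_max_left _ _) (hQ0 x))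
  -- If `P ≤ (1 + s)Y`, one step under `K` gives `P ≤ (1 + s)Y - sQ`. As `Q ≥ (1 - r)Y`, this is at
  -- most `(1 + rs)Y`, so the excess `s` shrinks by the factor `r` each time.
  have key : ∀ k : ℕ, ∀ x, quad P x ≤ (1 + r ^ k * C) * quad Y x := by
    intro k
    induction k with
    | zero => intro x; nlinarith [hPC x, hY0 x]
    | succ k ih =>
      intro x
      have h1 := hP.quad_le_stepValue hR hp.2 x (K *ᵥ x)
      have h2 := h x
      have h3 := mul_le_mul_of_nonneg_left (ih (A *ᵥ x)) hp.1
      have h4 := mul_le_mul_of_nonneg_left (ih (A *ᵥ x + B *ᵥ (K *ᵥ x))) (sub_nonneg.2 hp.2)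
      have h5 : 0 ≤ (1 - p) * quad R (K *ᵥ x) :=
        mul_nonneg (sub_nonneg.2 hp.2) (quad_nonneg hR.posSemidef _)
      have hs : 0 ≤ r ^ k * C := by positivity
      rw [stepValue] at h1 h2
      have h6 := mul_le_mul_of_nonneg_left h2 (by linarith : 0 ≤ 1 + r ^ k * C)
      have h7 := mul_le_mul_of_nonneg_left (hQY x) hs
      have h8 := mul_nonneg hs h5
      rw [pow_succ]
      nlinarith
  have hlim : Tendsto (fun k : ℕ => (1 + r ^ k * C) * quad Y x) atTop (𝓝 (quad Y x)) := by
    have := (((tendsto_pow_atTop_nhds_zero_of_lt_one hr0 hr1).mul_const C).const_add 1).mul_const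
      (quad Y x)
    simpa using this
  exact ge_of_tendsto' hlim fun k => key k x

end Riccati

/-! ### The information filtration and measurability of states. -/

section Information

variable {n m : ℕ} {Ω : Type*} {lam : ℕ → Ω → ℝ} {x₀ : Ω → Fin n → ℝ}
  {A : Matrix (Fin n) (Fin n) ℝ} {B : Matrix (Fin n) (Fin m) ℝ} {u : ℕ → Ω → Fin m → ℝ}

theorem info_mono (x₀ : Ω → Fin n → ℝ) (lam : ℕ → Ω → ℝ) : Monotone (info x₀ lam) :=
  fun _ _ h => sup_le_sup_left (iSup₂_le fun s hs =>
    le_iSup₂_of_le (f := fun r _ => MeasurableSpace.comap (lam r) inferInstance) s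
      (lt_of_lt_of_le hs h) le_rfl) _

theorem measurable_indicator_comap {β : Type*} [MeasurableSpace β] [Zero β] [One β] (f : Ω → ℝ)
    (c : ℝ) : Measurable[MeasurableSpace.comap f inferInstance]
      ({ω | f ω = c}.indicator (1 : Ω → β)) :=
  (measurable_one.indicator (measurableSet_singleton c)).comp (comap_measurable f)

theorem measurable_mulVec {k l : ℕ} (C : Matrix (Fin k) (Fin l) ℝ) :
    Measurable fun x : Fin l → ℝ => C *ᵥ x :=
  Continuous.measurable (by fun_prop)

theorem measurable_lam_info (x₀ : Ω → Fin n → ℝ) (lam : ℕ → Ω → ℝ) (t : ℕ) :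
    Measurable[info x₀ lam (t + 1)] (lam t) := by
  have h : MeasurableSpace.comap (lam t) inferInstance ≤ info x₀ lam (t + 1) :=
    le_sup_of_le_right (le_iSup₂_of_le
      (f := fun r _ => MeasurableSpace.comap (lam r) inferInstance) t t.lt_succ_self le_rfl)
  exact (comap_measurable (lam t)).mono h le_rfl

theorem Admissible.measurable_state (hu : Admissible x₀ lam u) (t : ℕ) :
    Measurable[info x₀ lam t] (state A B x₀ lam u t) := by
  induction t with
  | zero => exact (comap_measurable x₀).mono le_sup_left le_rfl
  | succ t ih =>
    have hm := info_mono x₀ lam t.le_succ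
    have h1 := (measurable_mulVec A).comp (ih.mono hm le_rfl)
    have h2 := (measurable_mulVec B).comp ((hu t).mono hm le_rfl)
    exact h1.add ((measurable_lam_info x₀ lam t).smul h2)

theorem measurable_feedbackState_info (K : Matrix (Fin m) (Fin n) ℝ) (t : ℕ) :
    Measurable[info x₀ lam t] (feedbackState A B x₀ lam K t) := by
  induction t with
  | zero => exact (comap_measurable x₀).mono le_sup_left le_rfl
  | succ t ih =>
    have h := ih.mono (info_mono x₀ lam t.le_succ) le_rfl
    have h1 := (measurable_mulVec A).comp h
    have h2 := (measurable_mulVec B).comp ((measurable_mulVec K).comp h)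
    exact h1.add ((measurable_lam_info x₀ lam t).smul h2)

theorem admissible_feedbackControl (K : Matrix (Fin m) (Fin n) ℝ) :
    Admissible x₀ lam (feedbackControl A B x₀ lam K) :=
  fun t => (measurable_mulVec K).comp (measurable_feedbackState_info K t)

variable [mΩ : MeasurableSpace Ω] {μ : Measure Ω} {q : ℝ}

theorem IsDropSequence.info_le (hlam : IsDropSequence μ q lam) (hx₀ : Measurable x₀) (t : ℕ) :
    info x₀ lam t ≤ mΩ :=
  sup_le hx₀.comap_le (iSup₂_le fun s _ => (hlam.measurable s).comap_le)

theorem IsDropSequence.measurableSet_eq (hlam : IsDropSequence μ q lam) (t : ℕ) (c : ℝ) :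
    MeasurableSet {ω | lam t ω = c} :=
  hlam.measurable t (measurableSet_singleton c)

end Information

/-! ### Independence of the next transmission from the past. -/

section Independence

variable {n m : ℕ} {Ω : Type*} [mΩ : MeasurableSpace Ω] {μ : Measure Ω} [IsProbabilityMeasure μ]

/-- Intersections of an `a`-set and a `b`-set form a π-system generating `a ⊔ b`. On them the
measure factors by splitting off the `a`-set first and then separating `b` from `c`. -/
theorem indep_sup_left {a b c : MeasurableSpace Ω} (ha : a ≤ mΩ) (hb : b ≤ mΩ) (hc : c ≤ mΩ)
    (h1 : Indep a (b ⊔ c) μ) (h2 : Indep b c μ) : Indep (a ⊔ b) c μ := by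
  set p : Set (Set Ω) := {s | ∃ u v, MeasurableSet[a] u ∧ MeasurableSet[b] v ∧ s = u ∩ v} with hp
  have hgen : a ⊔ b = MeasurableSpace.generateFrom p := by
    refine le_antisymm (sup_le ?_ ?_) (MeasurableSpace.generateFrom_le ?_)
    · exact fun s hs => MeasurableSpace.measurableSet_generateFrom
        ⟨s, Set.univ, hs, MeasurableSet.univ, by simp⟩
    · exact fun s hs => MeasurableSpace.measurableSet_generateFrom
        ⟨Set.univ, s, MeasurableSet.univ, hs, by simp⟩
    · rintro s ⟨u, v, hu, hv, rfl⟩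
      exact MeasurableSet.inter ((le_sup_left : a ≤ a ⊔ b) _ hu) ((le_sup_right : b ≤ a ⊔ b) _ hv)
  refine IndepSets.indep (sup_le ha hb) hc ?_ (@MeasurableSpace.isPiSystem_measurableSet Ω c) hgen
    (@MeasurableSpace.generateFrom_measurableSet Ω c).symm ?_
  · rintro _ ⟨u, v, hu, hv, rfl⟩ _ ⟨u', v', hu', hv', rfl⟩ -
    exact ⟨u ∩ u', v ∩ v', hu.inter hu', hv.inter hv', Set.inter_inter_inter_comm u v u' v'⟩
  · rw [IndepSets_iff]
    rintro _ w ⟨u, v, hu, hv, rfl⟩ hw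
    rw [Indep_iff] at h1 h2
    have hv' : MeasurableSet[b ⊔ c] v := (le_sup_left : b ≤ b ⊔ c) _ hv
    have hw' : MeasurableSet[b ⊔ c] w := (le_sup_right : c ≤ b ⊔ c) _ hw
    rw [Set.inter_assoc, h1 u (v ∩ w) hu (hv'.inter hw'), h2 v w hv hw, h1 u v hu hv', mul_assoc]

variable {q : ℝ} {lam : ℕ → Ω → ℝ} {x₀ : Ω → Fin n → ℝ}

/-- The initial state is independent of the whole sequence, and the earlier transmissions are
independent of the current one; `indep_sup_left` combines the two facts. -/
theorem IsDropSequence.indep_info (hlam : IsDropSequence μ q lam) (hx₀ : Measurable x₀)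
    (hindep : IndepFun x₀ (fun ω t => lam t ω) μ) (t : ℕ) :
    Indep (info x₀ lam t) (MeasurableSpace.comap (lam t) inferInstance) μ := by
  have hle : ∀ s, MeasurableSpace.comap (lam s) inferInstance ≤ mΩ :=
    fun s => (hlam.measurable s).comap_le
  have hseq : ∀ s, MeasurableSpace.comap (lam s) inferInstance
      ≤ MeasurableSpace.comap (fun ω t => lam t ω) MeasurableSpace.pi := fun s => by
    rintro _ ⟨v, hv, rfl⟩
    exact ⟨{f | f s ∈ v}, measurable_pi_apply s hv, rfl⟩
  refine indep_sup_left hx₀.comap_le (iSup₂_le fun s _ => hle s) (hle t) ?_ ?_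
  · exact indep_of_indep_of_le_right hindep (sup_le (iSup₂_le fun s _ => hseq s) (hseq t))
  · have h := indep_iSup_of_disjoint hle hlam.indep (S := Set.Iio t) (T := {t}) (by simp)
    simpa using h

theorem IsDropSequence.ae_eq_zero_or_one (hlam : IsDropSequence μ q lam)
    (hq : q ∈ Set.Ioo (0 : ℝ) 1) (t : ℕ) : ∀ᵐ ω ∂μ, lam t ω = 0 ∨ lam t ω = 1 := by
  have hd : Disjoint {ω | lam t ω = 0} {ω | lam t ω = 1} :=
    Set.disjoint_left.2 fun ω h0 h1 => zero_ne_one (α := ℝ) (h0.symm.trans h1)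
  have h : μ ({ω | lam t ω = 0} ∪ {ω | lam t ω = 1}) = 1 := by
    rw [measure_union hd (hlam.measurableSet_eq t 1), hlam.drop, hlam.arrive,
      ← ENNReal.ofReal_add hq.1.le (by linarith [hq.2])]
    simp
  exact (prob_compl_eq_zero_iff
    ((hlam.measurableSet_eq t 0).union (hlam.measurableSet_eq t 1))).2 h

/-- Conditioning on the transmission outcome at time `t`, for nonnegative functions. -/
theorem IsDropSequence.lintegral_eq (hlam : IsDropSequence μ q lam)
    (hq : q ∈ Set.Ioo (0 : ℝ) 1) (hx₀ : Measurable x₀)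
    (hindep : IndepFun x₀ (fun ω t => lam t ω) μ) (t : ℕ) {f₀ f₁ g : Ω → ℝ≥0∞}
    (h₀ : Measurable[info x₀ lam t] f₀) (h₁ : Measurable[info x₀ lam t] f₁)
    (hg₀ : ∀ ω, lam t ω = 0 → g ω = f₀ ω) (hg₁ : ∀ ω, lam t ω = 1 → g ω = f₁ ω) :
    ∫⁻ ω, g ω ∂μ
      = ENNReal.ofReal q * ∫⁻ ω, f₀ ω ∂μ + ENNReal.ofReal (1 - q) * ∫⁻ ω, f₁ ω ∂μ := by
  have hle := hlam.info_le hx₀ t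
  -- Almost everywhere `g` is a sum of two products, each of a function known at time `t` and the
  -- indicator of an outcome independent of that knowledge.
  have key : ∀ (c : ℝ) (f : Ω → ℝ≥0∞), Measurable[info x₀ lam t] f →
      ∫⁻ ω, f ω * ({ω | lam t ω = c}.indicator 1 ω) ∂μ
        = μ {ω | lam t ω = c} * ∫⁻ ω, f ω ∂μ := fun c f hf => by
    rw [lintegral_mul_eq_lintegral_mul_lintegral_of_independent_measurableSpace hle
      (hlam.measurable t).comap_le (hlam.indep_info hx₀ hindep t) hf
      (measurable_indicator_comap (lam t) c),
      lintegral_indicator_one (hlam.measurableSet_eq t c), mul_comm]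
  rw [← hlam.drop t, ← hlam.arrive t, ← key 0 f₀ h₀, ← key 1 f₁ h₁, ← lintegral_add_left]
  · refine lintegral_congr_ae ?_
    filter_upwards [hlam.ae_eq_zero_or_one hq t] with ω hω
    rcases hω with h | h
    · simp [h, hg₀ ω h]
    · simp [h, hg₁ ω h]
  · exact (h₀.mono hle le_rfl).mul (measurable_one.indicator (hlam.measurableSet_eq t 0))

/-- Conditioning on the transmission outcome at time `t`, for integrable functions. -/
theorem IsDropSequence.integral_eq (hlam : IsDropSequence μ q lam)
    (hq : q ∈ Set.Ioo (0 : ℝ) 1) (hx₀ : Measurable x₀)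
    (hindep : IndepFun x₀ (fun ω t => lam t ω) μ) (t : ℕ) {f₀ f₁ g : Ω → ℝ}
    (h₀ : Measurable[info x₀ lam t] f₀) (h₁ : Measurable[info x₀ lam t] f₁)
    (hi₀ : Integrable f₀ μ) (hi₁ : Integrable f₁ μ)
    (hg₀ : ∀ ω, lam t ω = 0 → g ω = f₀ ω) (hg₁ : ∀ ω, lam t ω = 1 → g ω = f₁ ω) :
    ∫ ω, g ω ∂μ = q * ∫ ω, f₀ ω ∂μ + (1 - q) * ∫ ω, f₁ ω ∂μ := by
  have key : ∀ (c p : ℝ) (f : Ω → ℝ), 0 ≤ p → μ {ω | lam t ω = c} = ENNReal.ofReal p →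
      Measurable[info x₀ lam t] f → Integrable f μ →
      Integrable (fun ω => f ω * ({ω | lam t ω = c}.indicator 1 ω)) μ ∧
      ∫ ω, f ω * ({ω | lam t ω = c}.indicator 1 ω) ∂μ = p * ∫ ω, f ω ∂μ :=
    fun c p f hp hc hf hi => by
    have hs := hlam.measurableSet_eq t c
    have hind : Integrable ({ω | lam t ω = c}.indicator (1 : Ω → ℝ)) μ :=
      (integrable_const 1).indicator hs
    have hI : IndepFun f ({ω | lam t ω = c}.indicator (1 : Ω → ℝ)) μ :=
      indep_of_indep_of_le (hlam.indep_info hx₀ hindep t) hf.comap_le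
        (measurable_indicator_comap (lam t) c).comap_le
    refine ⟨hI.integrable_mul hi hind, ?_⟩
    rw [hI.integral_fun_mul_eq_mul_integral hi.1 hind.1, integral_indicator_one hs, measureReal_def,
      hc, ENNReal.toReal_ofReal hp, mul_comm]
  have k₀ := key 0 q f₀ hq.1.le (hlam.drop t) h₀ hi₀
  have k₁ := key 1 (1 - q) f₁ (by linarith [hq.2]) (hlam.arrive t) h₁ hi₁
  rw [← k₀.2, ← k₁.2, ← integral_add k₀.1 k₁.1]
  refine integral_congr_ae ?_
  filter_upwards [hlam.ae_eq_zero_or_one hq t] with ω hω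
  rcases hω with h | h
  · simp [h, hg₀ ω h]
  · simp [h, hg₁ ω h]

end Independence

/-! ### Dynamic programming and the optimal cost. -/

section Cost

variable {n m : ℕ} {Ω : Type*} [mΩ : MeasurableSpace Ω] {μ : Measure Ω}
  {q : ℝ} {lam : ℕ → Ω → ℝ} {x₀ : Ω → Fin n → ℝ}
  {A : Matrix (Fin n) (Fin n) ℝ} {B : Matrix (Fin n) (Fin m) ℝ}
  {Q : Matrix (Fin n) (Fin n) ℝ} {R : Matrix (Fin m) (Fin m) ℝ} {u : ℕ → Ω → Fin m → ℝ}

/-- The expected cost incurred at time `t`. -/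
noncomputable def stageCost (μ : Measure Ω) (A : Matrix (Fin n) (Fin n) ℝ)
    (B : Matrix (Fin n) (Fin m) ℝ) (Q : Matrix (Fin n) (Fin n) ℝ) (R : Matrix (Fin m) (Fin m) ℝ)
    (x₀ : Ω → Fin n → ℝ) (lam : ℕ → Ω → ℝ) (u : ℕ → Ω → Fin m → ℝ) (t : ℕ) : ℝ≥0∞ :=
  ∫⁻ ω, ENNReal.ofReal (quad Q (state A B x₀ lam u t ω) + lam t ω * quad R (u t ω)) ∂μ

theorem IsDropSequence.measurable_stage (hlam : IsDropSequence μ q lam) (hx₀ : Measurable x₀)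
    (hu : Admissible x₀ lam u) (t : ℕ) : Measurable fun ω => ENNReal.ofReal
      (quad Q (state A B x₀ lam u t ω) + lam t ω * quad R (u t ω)) := by
  have hle := hlam.info_le hx₀ t
  have h1 := (measurable_quad Q).comp ((hu.measurable_state (A := A) (B := B) t).mono hle le_rfl)
  have h2 := (measurable_quad R).comp ((hu t).mono hle le_rfl)
  exact (h1.add ((hlam.measurable t).mul h2)).ennreal_ofReal

theorem IsDropSequence.cost_eq_tsum (hlam : IsDropSequence μ q lam) (hx₀ : Measurable x₀)
    (hu : Admissible x₀ lam u) :
    cost μ A B Q R x₀ lam u = ∑' t, stageCost μ A B Q R x₀ lam u t :=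
  lintegral_tsum fun t => (hlam.measurable_stage hx₀ hu t).aemeasurable

theorem lintegral_quad_le_stageCost
    (hae : ∀ t, ∀ᵐ ω ∂μ, lam t ω = 0 ∨ lam t ω = 1) (hR : R.PosDef) (t : ℕ) :
    ∫⁻ ω, ENNReal.ofReal (quad Q (state A B x₀ lam u t ω)) ∂μ
      ≤ stageCost μ A B Q R x₀ lam u t := by
  refine lintegral_mono_ae ?_
  filter_upwards [hae t] with ω hω
  refine ENNReal.ofReal_le_ofReal (le_add_of_nonneg_right (mul_nonneg ?_
    (quad_nonneg hR.posSemidef _)))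
  rcases hω with h | h <;> simp [h]

variable [IsProbabilityMeasure μ]

/-- The one-step dynamic programming identity. -/
theorem IsDropSequence.stageCost_add (hlam : IsDropSequence μ q lam)
    (hq : q ∈ Set.Ioo (0 : ℝ) 1) (hx₀ : Measurable x₀)
    (hindep : IndepFun x₀ (fun ω t => lam t ω) μ) (hQ : Q.PosDef) (hR : R.PosDef)
    (hu : Admissible x₀ lam u) {Y : Matrix (Fin n) (Fin n) ℝ} (hY : Y.PosSemidef) (t : ℕ) :
    stageCost μ A B Q R x₀ lam u t
        + ∫⁻ ω, ENNReal.ofReal (quad Y (state A B x₀ lam u (t + 1) ω)) ∂μ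
      = ∫⁻ ω, ENNReal.ofReal
          (stepValue A B Q R q Y (state A B x₀ lam u t ω) (u t ω)) ∂μ := by
  have hle := hlam.info_le hx₀ t
  have hx := hu.measurable_state (A := A) (B := B) t
  have hQ0 := fun x => quad_nonneg hQ.posSemidef x
  have hR0 := fun x => quad_nonneg hR.posSemidef x
  have hY0 := fun x => quad_nonneg hY x
  have hAx := (measurable_mulVec A).comp hx
  -- The two branches of the integrand: after a loss neither the control nor its cost enters, after
  -- an arrival both do.
  have m₀ : Measurable[info x₀ lam t] fun ω => ENNReal.ofReal
      (quad Q (state A B x₀ lam u t ω) + quad Y (A *ᵥ state A B x₀ lam u t ω)) :=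
    (((measurable_quad Q).comp hx).add ((measurable_quad Y).comp hAx)).ennreal_ofReal
  have m₁ : Measurable[info x₀ lam t] fun ω => ENNReal.ofReal
      (quad Q (state A B x₀ lam u t ω) + quad R (u t ω)
        + quad Y (A *ᵥ state A B x₀ lam u t ω + B *ᵥ u t ω)) :=
    ((((measurable_quad Q).comp hx).add ((measurable_quad R).comp (hu t))).add
      ((measurable_quad Y).comp (hAx.add ((measurable_mulVec B).comp (hu t))))).ennreal_ofReal
  rw [stageCost, ← lintegral_add_left (hlam.measurable_stage hx₀ hu t),
    hlam.lintegral_eq hq hx₀ hindep t m₀ m₁, ← lintegral_const_mul _ (m₀.mono hle le_rfl),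
    ← lintegral_const_mul _ (m₁.mono hle le_rfl),
    ← lintegral_add_left ((m₀.mono hle le_rfl).const_mul _)]
  · refine lintegral_congr fun ω => ?_
    have hq1 : 0 ≤ 1 - q := by linarith [hq.2]
    have a1 := hQ0 (state A B x₀ lam u t ω)
    have a2 := hR0 (u t ω)
    have a3 := hY0 (A *ᵥ state A B x₀ lam u t ω)
    have a4 := hY0 (A *ᵥ state A B x₀ lam u t ω + B *ᵥ u t ω)
    rw [← ENNReal.ofReal_mul hq.1.le, ← ENNReal.ofReal_mul hq1, ← ENNReal.ofReal_add
      (mul_nonneg hq.1.le (by positivity)) (mul_nonneg hq1 (by positivity)), stepValue]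
    congr 1
    ring
  · intro ω h
    rw [← ENNReal.ofReal_add (by simpa [h] using hQ0 _) (hY0 _)]
    simp [h, state]
  · intro ω h
    rw [← ENNReal.ofReal_add (by simpa [h] using add_nonneg (hQ0 _) (hR0 _)) (hY0 _)]
    simp [h, state]

/-- Along a control of finite cost, every quadratic form of the state tends to zero in mean. -/
theorem IsDropSequence.tendsto_lintegral_quad (hlam : IsDropSequence μ q lam)
    (hq : q ∈ Set.Ioo (0 : ℝ) 1) (hx₀ : Measurable x₀) (hQ : Q.PosDef) (hR : R.PosDef)
    (hu : Admissible x₀ lam u) (hfin : cost μ A B Q R x₀ lam u ≠ ⊤)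
    (Y : Matrix (Fin n) (Fin n) ℝ) :
    Tendsto (fun t => ∫⁻ ω, ENNReal.ofReal (quad Y (state A B x₀ lam u t ω)) ∂μ) atTop
      (𝓝 0) := by
  obtain ⟨c, hc, hYQ⟩ := exists_quad_le_mul_quad hQ Y
  rw [hlam.cost_eq_tsum hx₀ hu] at hfin
  have h0 := ENNReal.Tendsto.const_mul (ENNReal.tendsto_atTop_zero_of_tsum_ne_top hfin)
    (Or.inr (ENNReal.ofReal_ne_top (r := c)))
  rw [mul_zero] at h0
  refine tendsto_of_tendsto_of_tendsto_of_le_of_le tendsto_const_nhds h0 (fun _ => zero_le)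
    fun t => ?_
  calc ∫⁻ ω, ENNReal.ofReal (quad Y (state A B x₀ lam u t ω)) ∂μ
      ≤ ∫⁻ ω, ENNReal.ofReal c * ENNReal.ofReal (quad Q (state A B x₀ lam u t ω)) ∂μ := by
        refine lintegral_mono fun ω => ?_
        rw [← ENNReal.ofReal_mul hc.le]
        exact ENNReal.ofReal_le_ofReal (hYQ _)
    _ = ENNReal.ofReal c * ∫⁻ ω, ENNReal.ofReal (quad Q (state A B x₀ lam u t ω)) ∂μ :=
        lintegral_const_mul' _ _ ENNReal.ofReal_ne_top
    _ ≤ _ := by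
        gcongr
        exact lintegral_quad_le_stageCost (hlam.ae_eq_zero_or_one hq) hR t

/-- The value of the Riccati solution bounds the cost of every admissible control from below. -/
theorem IsDropSequence.lintegral_quad_le_cost (hlam : IsDropSequence μ q lam)
    (hq : q ∈ Set.Ioo (0 : ℝ) 1) (hx₀ : Measurable x₀)
    (hindep : IndepFun x₀ (fun ω t => lam t ω) μ) (hQ : Q.PosDef) (hR : R.PosDef)
    {P : Matrix (Fin n) (Fin n) ℝ} (hP : IsRiccatiSolution A B Q R q P)
    (hu : Admissible x₀ lam u) :
    ∫⁻ ω, ENNReal.ofReal (quad P (x₀ ω)) ∂μ ≤ cost μ A B Q R x₀ lam u := by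
  by_cases hfin : cost μ A B Q R x₀ lam u = ⊤
  · rw [hfin]; exact le_top
  have hpart : ∀ T : ℕ, ∫⁻ ω, ENNReal.ofReal (quad P (x₀ ω)) ∂μ
      ≤ cost μ A B Q R x₀ lam u
        + ∫⁻ ω, ENNReal.ofReal (quad P (state A B x₀ lam u T ω)) ∂μ := by
    intro T
    rw [hlam.cost_eq_tsum hx₀ hu]
    -- The total cost is replaced by its first `T` stages, so that the one-step inequality
    -- telescopes by induction.
    refine le_trans ?_ (add_le_add_left (ENNReal.sum_le_tsum (Finset.range T)) _)
    induction T with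
    | zero => simp [state]
    | succ T ih =>
      refine ih.trans ?_
      rw [Finset.sum_range_succ, add_assoc, hlam.stageCost_add hq hx₀ hindep hQ hR hu
        hP.posDef.posSemidef]
      gcongr
      exact hP.quad_le_stepValue hR hq.2.le _ _
  have hlim := (hlam.tendsto_lintegral_quad hq hx₀ hQ hR hu hfin P).const_add
    (cost μ A B Q R x₀ lam u)
  rw [add_zero] at hlim
  exact ge_of_tendsto' hlim hpart

/-- A value that the closed loop does not increase bounds the cost of the feedback from above. -/
theorem IsDropSequence.cost_feedback_le (hlam : IsDropSequence μ q lam)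
    (hq : q ∈ Set.Ioo (0 : ℝ) 1) (hx₀ : Measurable x₀)
    (hindep : IndepFun x₀ (fun ω t => lam t ω) μ) (hQ : Q.PosDef) (hR : R.PosDef)
    {Y : Matrix (Fin n) (Fin n) ℝ} (hY : Y.PosSemidef) {K : Matrix (Fin m) (Fin n) ℝ}
    (h : ∀ x, stepValue A B Q R q Y x (K *ᵥ x) ≤ quad Y x) :
    cost μ A B Q R x₀ lam (feedbackControl A B x₀ lam K)
      ≤ ∫⁻ ω, ENNReal.ofReal (quad Y (x₀ ω)) ∂μ := by
  have hu : Admissible x₀ lam (feedbackControl A B x₀ lam K) := admissible_feedbackControl K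
  rw [hlam.cost_eq_tsum hx₀ hu, ENNReal.tsum_eq_iSup_nat]
  refine iSup_le fun T => ?_
  have hpart : ∑ t ∈ Finset.range T, stageCost μ A B Q R x₀ lam (feedbackControl A B x₀ lam K) t
      + ∫⁻ ω, ENNReal.ofReal
          (quad Y (state A B x₀ lam (feedbackControl A B x₀ lam K) T ω)) ∂μ
      ≤ ∫⁻ ω, ENNReal.ofReal (quad Y (x₀ ω)) ∂μ := by
    induction T with
    | zero => simp [state]
    | succ T ih =>
      refine le_trans ?_ ih
      rw [Finset.sum_range_succ, add_assoc, hlam.stageCost_add hq hx₀ hindep hQ hR hu hY]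
      gcongr with ω
      simp only [feedbackControl, ← state_feedbackControl]
      exact h _
  exact le_self_add.trans hpart

/-- The optimal cost is the expected value of the Riccati solution at the initial state. -/
theorem IsDropSequence.optimalCost_eq (hlam : IsDropSequence μ q lam)
    (hq : q ∈ Set.Ioo (0 : ℝ) 1) (hx₀ : Measurable x₀)
    (hindep : IndepFun x₀ (fun ω t => lam t ω) μ) (hQ : Q.PosDef) (hR : R.PosDef)
    {P : Matrix (Fin n) (Fin n) ℝ} (hP : IsRiccatiSolution A B Q R q P) :
    optimalCost μ A B Q R x₀ lam = ∫⁻ ω, ENNReal.ofReal (quad P (x₀ ω)) ∂μ := by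
  refine le_antisymm ?_ (le_iInf₂ fun u hu => hlam.lintegral_quad_le_cost hq hx₀ hindep hQ hR hP hu)
  refine (iInf₂_le _ (admissible_feedbackControl (A := A) (B := B) (gain A B R P))).trans ?_
  refine hlam.cost_feedback_le hq hx₀ hindep hQ hR hP.posDef.posSemidef fun x => ?_
  rw [hP.stepValue_gain_eq hR]
  simp

/-- A finite cost forces the stage costs to tend to zero, and `Q` dominates a multiple of the
identity form. -/
theorem IsDropSequence.meanSquareStabilizes (hlam : IsDropSequence μ q lam)
    (hq : q ∈ Set.Ioo (0 : ℝ) 1) (hx₀ : Measurable x₀) (hQ : Q.PosDef) (hR : R.PosDef)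
    {K : Matrix (Fin m) (Fin n) ℝ}
    (hfin : cost μ A B Q R x₀ lam (feedbackControl A B x₀ lam K) ≠ ⊤) :
    MeanSquareStabilizes μ A B x₀ lam K := by
  have h := hlam.tendsto_lintegral_quad hq hx₀ hQ hR (admissible_feedbackControl K) hfin 1
  simpa [MeanSquareStabilizes, quad, state_feedbackControl] using h

end Cost

/-! ### Summability of vanishing iterates of a linear map. -/

/-- If the iterates of a linear map at a vector tend to zero, then their partial sums converge. -/
theorem exists_tendsto_sum_pow_apply {V : Type*} [AddCommGroup V] [Module ℝ V]
    [TopologicalSpace V] [IsTopologicalAddGroup V] [ContinuousSMul ℝ V] [T2Space V]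
    [FiniteDimensional ℝ V] (T : V →ₗ[ℝ] V) (v : V)
    (h : Tendsto (fun k => (T ^ k) v) atTop (𝓝 0)) :
    ∃ s, Tendsto (fun N => ∑ k ∈ Finset.range N, (T ^ k) v) atTop (𝓝 s) := by
  -- Only the orbit of `v` is known to vanish, so `T` may be unstable elsewhere. The vectors with
  -- vanishing orbit form a `T`-invariant subspace on which `1 - T` can be inverted.
  let W : Submodule ℝ V :=
    { carrier := {w | Tendsto (fun k => (T ^ k) w) atTop (𝓝 0)}
      add_mem' := fun {a b} ha hb => by
        have := Tendsto.add ha hb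
        simpa using this
      zero_mem' := by simp
      smul_mem' := fun c a ha => by
        have := Tendsto.const_smul ha c
        simpa using this }
  have hTW : ∀ w ∈ W, T w ∈ W := fun w hw => by
    have h1 : Tendsto (fun k => (T ^ (k + 1)) w) atTop (𝓝 0) := (tendsto_add_atTop_iff_nat 1).2 hw
    simp only [pow_succ, Module.End.mul_apply] at h1
    exact h1
  let S : Module.End ℝ W := T.restrict hTW
  have hS : ∀ (k : ℕ) (w : W), (((S ^ k) w : W) : V) = (T ^ k) w := fun k w => by
    induction k generalizing w with
    | zero => simp
    | succ k ih => rw [pow_succ, pow_succ, Module.End.mul_apply, Module.End.mul_apply, ih]; rfl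
  -- A kernel vector of `1 - S` is fixed by `T`; its orbit is constant and tends to zero, so it is
  -- zero. In finite dimension injectivity gives the inverse, and the geometric sum formula then
  -- yields the limit.
  have hinj : Function.Injective ((1 - S : Module.End ℝ W)) := by
    rw [← LinearMap.ker_eq_bot, LinearMap.ker_eq_bot']
    intro w hw
    have hfix : T w = w := by
      have h1 : (w : V) - T w = 0 := congrArg Subtype.val hw
      exact (sub_eq_zero.1 h1).symm
    have hpow : ∀ k : ℕ, (T ^ k) (w : V) = w := fun k => by
      induction k with
      | zero => simp
      | succ k ih => rw [pow_succ, Module.End.mul_apply, hfix, ih]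
    have hlim : Tendsto (fun k => (T ^ k) (w : V)) atTop (𝓝 0) := w.2
    simp only [hpow] at hlim
    exact Subtype.ext (tendsto_nhds_unique tendsto_const_nhds hlim)
  let e := LinearEquiv.ofInjectiveEndo (1 - S) hinj
  let v' : W := ⟨v, h⟩
  have hsum : ∀ N : ℕ, ∑ k ∈ Finset.range N, (S ^ k) v' = e.symm (v' - (S ^ N) v') := fun N => by
    rw [LinearEquiv.eq_symm_apply]
    have h1 := congrArg (fun f : Module.End ℝ W => f v') (mul_neg_geom_sum S N)
    simp only [Module.End.mul_apply, LinearMap.sum_apply] at h1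
    exact h1
  have hlim : Tendsto (fun N => (S ^ N) v') atTop (𝓝 0) := by
    rw [tendsto_subtype_rng]
    simp only [hS]
    exact h
  have hcont : Continuous e.symm :=
    LinearMap.continuous_of_finiteDimensional (e.symm : W →ₗ[ℝ] W)
  have h2 := (hcont.tendsto _).comp (hlim.const_sub v')
  refine ⟨_, ((continuous_subtype_val.tendsto _).comp h2).congr fun N => ?_⟩
  rw [Function.comp_apply, Function.comp_apply, ← hsum, Submodule.coe_sum]
  simp only [hS, v']

/-! ### Second moments of the closed loop. -/

section Moments

variable {n m : ℕ} {Ω : Type*} [mΩ : MeasurableSpace Ω] {μ : Measure Ω}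

theorem integral_quad {x : Ω → Fin n → ℝ} (hx : ∀ i j, Integrable (fun ω => x ω i * x ω j) μ)
    (N : Matrix (Fin n) (Fin n) ℝ) : Integrable (fun ω => quad N (x ω)) μ ∧
      ∫ ω, quad N (x ω) ∂μ = (N * initialMoment μ x).trace := by
  have h : ∀ ω, quad N (x ω) = ∑ i, ∑ j, N i j * (x ω j * x ω i) := fun ω => by
    simp only [quad, dotProduct, mulVec, Finset.mul_sum]
    exact Finset.sum_congr rfl fun i _ => Finset.sum_congr rfl fun j _ => by ring
  have hi : ∀ i j, Integrable (fun ω => N i j * (x ω j * x ω i)) μ :=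
    fun i j => (hx j i).const_mul _
  simp only [h]
  refine ⟨integrable_finsetSum _ fun i _ => integrable_finsetSum _ fun j _ => hi i j, ?_⟩
  rw [integral_finsetSum _ fun i _ => integrable_finsetSum _ fun j _ => hi i j]
  simp only [trace, diag, mul_apply, initialMoment, of_apply]
  refine Finset.sum_congr rfl fun i _ => ?_
  rw [integral_finsetSum _ fun j _ => hi i j]
  exact Finset.sum_congr rfl fun j _ => integral_const_mul _ _

theorem lintegral_quad {x : Ω → Fin n → ℝ} (hx : ∀ i j, Integrable (fun ω => x ω i * x ω j) μ)
    {N : Matrix (Fin n) (Fin n) ℝ} (hN : N.PosSemidef) :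
    ∫⁻ ω, ENNReal.ofReal (quad N (x ω)) ∂μ
      = ENNReal.ofReal ((N * initialMoment μ x).trace) := by
  obtain ⟨h1, h2⟩ := integral_quad hx N
  rw [← h2, ofReal_integral_eq_lintegral_ofReal h1 (ae_of_all _ fun ω => quad_nonneg hN _)]

theorem initialMoment_mulVec {x : Ω → Fin n → ℝ}
    (hx : ∀ i j, Integrable (fun ω => x ω i * x ω j) μ) (C : Matrix (Fin n) (Fin n) ℝ) :
    (∀ i j, Integrable (fun ω => (C *ᵥ x ω) i * (C *ᵥ x ω) j) μ) ∧
      initialMoment μ (fun ω => C *ᵥ x ω) = C * initialMoment μ x * Cᵀ := by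
  have h : ∀ ω i j, (C *ᵥ x ω) i * (C *ᵥ x ω) j
      = ∑ l, ∑ k, C i k * C j l * (x ω k * x ω l) := fun ω i j => by
    simp only [mulVec, dotProduct, Finset.sum_mul_sum]
    rw [Finset.sum_comm]
    exact Finset.sum_congr rfl fun l _ => Finset.sum_congr rfl fun k _ => by ring
  have hi : ∀ i j k l, Integrable (fun ω => C i k * C j l * (x ω k * x ω l)) μ :=
    fun i j k l => (hx k l).const_mul _
  refine ⟨fun i j => ?_, ?_⟩
  · simp only [h]
    exact integrable_finsetSum _ fun l _ => integrable_finsetSum _ fun k _ => hi i j k l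
  · ext i j
    simp only [initialMoment, of_apply, h, mul_apply, transpose_apply]
    rw [integral_finsetSum _ fun l _ => integrable_finsetSum _ fun k _ => hi i j k l]
    refine Finset.sum_congr rfl fun l _ => ?_
    rw [integral_finsetSum _ fun k _ => hi i j k l, Finset.sum_mul]
    refine Finset.sum_congr rfl fun k _ => ?_
    rw [integral_const_mul]
    ring

theorem posSemidef_initialMoment {x : Ω → Fin n → ℝ}
    (hx : ∀ i j, Integrable (fun ω => x ω i * x ω j) μ) : (initialMoment μ x).PosSemidef := by
  refine .of_dotProduct_mulVec_nonneg ?_ fun y => ?_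
  · ext i j
    simp [initialMoment, mul_comm]
  -- The rank-one form of `y yᵀ` is the square of `y ⬝ᵥ x`, and its mean is the quadratic form of
  -- the moment matrix at `y`.
  · have h := (integral_quad hx (vecMulVec y y)).2
    have h1 : ∀ z : Fin n → ℝ, quad (vecMulVec y y) z = (y ⬝ᵥ z) ^ 2 := fun z => by
      simp [quad, vecMulVec_mulVec, dotProduct_comm z y, sq]
    rw [vecMulVec_mul, trace_vecMulVec, dotProduct_comm, ← dotProduct_mulVec] at h
    rw [star_trivial, ← h]
    exact integral_nonneg fun ω => by rw [h1]; positivity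

/-- From `2|xᵢxⱼ| ≤ xᵢ² + xⱼ²`. It makes the trace control every entry, so that convergence and
summability need only be checked for traces. -/
theorem integral_norm_mul_le_trace {x : Ω → Fin n → ℝ}
    (hx : ∀ i j, Integrable (fun ω => x ω i * x ω j) μ) (i j : Fin n) :
    ∫ ω, ‖x ω i * x ω j‖ ∂μ ≤ (initialMoment μ x).trace := by
  have h := integral_quad hx 1
  rw [one_mul] at h
  rw [← h.2]
  refine integral_mono (hx i j).norm h.1 fun ω => ?_
  have h1 : quad 1 (x ω) = ∑ k, x ω k * x ω k := by simp [quad, dotProduct]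
  have hi := Finset.single_le_sum (f := fun k => x ω k * x ω k)
    (fun k _ => mul_self_nonneg _) (Finset.mem_univ i)
  have hj := Finset.single_le_sum (f := fun k => x ω k * x ω k)
    (fun k _ => mul_self_nonneg _) (Finset.mem_univ j)
  simp only [h1, Real.norm_eq_abs]
  rw [abs_le]
  constructor <;> nlinarith [sq_nonneg (x ω i - x ω j), sq_nonneg (x ω i + x ω j)]

/-- The evolution of the second moment of the closed-loop state. -/
def momentStep (A : Matrix (Fin n) (Fin n) ℝ) (B : Matrix (Fin n) (Fin m) ℝ)
    (K : Matrix (Fin m) (Fin n) ℝ) (q : ℝ) :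
    Matrix (Fin n) (Fin n) ℝ →ₗ[ℝ] Matrix (Fin n) (Fin n) ℝ where
  toFun M := q • (A * M * Aᵀ) + (1 - q) • ((A + B * K) * M * (A + B * K)ᵀ)
  map_add' M N := by simp only [Matrix.mul_add, Matrix.add_mul, smul_add]; abel
  map_smul' c M := by
    simp only [Matrix.mul_smul, Matrix.smul_mul, smul_add, RingHom.id_apply, smul_comm c]

variable [IsProbabilityMeasure μ] {q : ℝ} {lam : ℕ → Ω → ℝ} {x₀ : Ω → Fin n → ℝ}
  {A : Matrix (Fin n) (Fin n) ℝ} {B : Matrix (Fin n) (Fin m) ℝ}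
  {Q : Matrix (Fin n) (Fin n) ℝ} {R : Matrix (Fin m) (Fin m) ℝ} {K : Matrix (Fin m) (Fin n) ℝ}

theorem IsDropSequence.moment_succ (hlam : IsDropSequence μ q lam)
    (hq : q ∈ Set.Ioo (0 : ℝ) 1) (hx₀ : Measurable x₀)
    (hindep : IndepFun x₀ (fun ω t => lam t ω) μ) (t : ℕ)
    (hx : ∀ i j, Integrable (fun ω => feedbackState A B x₀ lam K t ω i
      * feedbackState A B x₀ lam K t ω j) μ) :
    (∀ i j, Integrable (fun ω => feedbackState A B x₀ lam K (t + 1) ω i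
      * feedbackState A B x₀ lam K (t + 1) ω j) μ) ∧
    initialMoment μ (feedbackState A B x₀ lam K (t + 1))
      = momentStep A B K q (initialMoment μ (feedbackState A B x₀ lam K t)) := by
  set x := feedbackState A B x₀ lam K t with hxdef
  have hm : Measurable[info x₀ lam t] x := measurable_feedbackState_info K t
  have hmC : ∀ (C : Matrix (Fin n) (Fin n) ℝ) (i j : Fin n),
      Measurable[info x₀ lam t] fun ω => (C *ᵥ x ω) i * (C *ᵥ x ω) j := fun C i j => by
    have h := (measurable_mulVec C).comp hm
    exact ((measurable_pi_apply i).comp h).mul ((measurable_pi_apply j).comp h)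
  have hA := initialMoment_mulVec hx A
  have hAB := initialMoment_mulVec hx (A + B * K)
  have h0 : ∀ ω, lam t ω = 0 → feedbackState A B x₀ lam K (t + 1) ω = A *ᵥ x ω :=
    fun ω h => by simp [feedbackState, h, hxdef]
  have h1 : ∀ ω, lam t ω = 1 → feedbackState A B x₀ lam K (t + 1) ω = (A + B * K) *ᵥ x ω :=
    fun ω h => by simp [feedbackState, h, hxdef, add_mulVec, mulVec_mulVec]
  have hmeas : ∀ i j, Measurable fun ω => feedbackState A B x₀ lam K (t + 1) ω i
      * feedbackState A B x₀ lam K (t + 1) ω j := fun i j => by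
    have h := (measurable_feedbackState_info (A := A) (B := B) (x₀ := x₀) (lam := lam) K
      (t + 1)).mono (hlam.info_le hx₀ (t + 1)) le_rfl
    exact ((measurable_pi_apply i).comp h).mul ((measurable_pi_apply j).comp h)
  refine ⟨fun i j => ?_, ?_⟩
  · refine ((hA.1 i j).norm.add (hAB.1 i j).norm).mono' (hmeas i j).aestronglyMeasurable ?_
    filter_upwards [hlam.ae_eq_zero_or_one hq t] with ω hω
    rcases hω with h | h
    · rw [h0 ω h]; exact le_add_of_nonneg_right (norm_nonneg _)
    · rw [h1 ω h]; exact le_add_of_nonneg_left (norm_nonneg _)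
  · ext i j
    have h := hlam.integral_eq hq hx₀ hindep t (hmC A i j) (hmC (A + B * K) i j) (hA.1 i j)
      (hAB.1 i j) (g := fun ω => feedbackState A B x₀ lam K (t + 1) ω i
        * feedbackState A B x₀ lam K (t + 1) ω j)
      (fun ω h => by simp only [h0 ω h]) (fun ω h => by simp only [h1 ω h])
    have eA := congrFun (congrFun hA.2 i) j
    have eAB := congrFun (congrFun hAB.2 i) j
    simp only [initialMoment, of_apply] at eA eAB
    rw [eA, eAB] at h
    simpa [momentStep, initialMoment] using h

theorem IsDropSequence.moment_eq_pow (hlam : IsDropSequence μ q lam)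
    (hq : q ∈ Set.Ioo (0 : ℝ) 1) (hx₀ : Measurable x₀)
    (hindep : IndepFun x₀ (fun ω t => lam t ω) μ)
    (hx : ∀ i j, Integrable (fun ω => x₀ ω i * x₀ ω j) μ) (t : ℕ) :
    (∀ i j, Integrable (fun ω => feedbackState A B x₀ lam K t ω i
      * feedbackState A B x₀ lam K t ω j) μ) ∧
    initialMoment μ (feedbackState A B x₀ lam K t)
      = (momentStep A B K q ^ t) (initialMoment μ x₀) := by
  induction t with
  | zero => exact ⟨hx, rfl⟩
  | succ t ih =>
    have h := hlam.moment_succ hq hx₀ hindep t ih.1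
    exact ⟨h.1, by rw [h.2, ih.2, pow_succ', Module.End.mul_apply]⟩

/-- Under a stabilizing feedback the second moments tend to zero and have a convergent sum, which
is the second moment `E [∑ t, xₜ xₜᵀ]`. -/
theorem IsDropSequence.hasSum_moment (hlam : IsDropSequence μ q lam)
    (hq : q ∈ Set.Ioo (0 : ℝ) 1) (hx₀ : Measurable x₀)
    (hindep : IndepFun x₀ (fun ω t => lam t ω) μ)
    (hx : ∀ i j, Integrable (fun ω => x₀ ω i * x₀ ω j) μ)
    (hK : MeanSquareStabilizes μ A B x₀ lam K) :
    MomentSumFinite μ A B x₀ lam K ∧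
    Tendsto (fun t => initialMoment μ (feedbackState A B x₀ lam K t)) atTop (𝓝 0) ∧
    HasSum (fun t => initialMoment μ (feedbackState A B x₀ lam K t))
      (momentSum μ A B x₀ lam K) := by
  have hpow := fun t => hlam.moment_eq_pow (A := A) (B := B) (K := K) hq hx₀ hindep hx t
  have htr0 : ∀ t, 0 ≤ (initialMoment μ (feedbackState A B x₀ lam K t)).trace :=
    fun t => (posSemidef_initialMoment (hpow t).1).trace_nonneg
  have htr : Tendsto (fun t => (initialMoment μ (feedbackState A B x₀ lam K t)).trace) atTop
      (𝓝 0) := by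
    have h : ∀ t, ∫⁻ ω, ENNReal.ofReal
        (feedbackState A B x₀ lam K t ω ⬝ᵥ feedbackState A B x₀ lam K t ω) ∂μ
        = ENNReal.ofReal (initialMoment μ (feedbackState A B x₀ lam K t)).trace := fun t => by
      have := lintegral_quad (hpow t).1 Matrix.PosSemidef.one
      simpa [quad] using this
    unfold MeanSquareStabilizes at hK
    simp only [h] at hK
    have := (ENNReal.tendsto_toReal ENNReal.zero_ne_top).comp hK
    simpa [Function.comp_def, ENNReal.toReal_ofReal, htr0] using this
  have hlim : Tendsto (fun t => initialMoment μ (feedbackState A B x₀ lam K t)) atTop (𝓝 0) := by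
    refine tendsto_pi_nhds.2 fun i => tendsto_pi_nhds.2 fun j => ?_
    refine squeeze_zero_norm (fun t => ?_) htr
    exact (norm_integral_le_integral_norm _).trans (integral_norm_mul_le_trace (hpow t).1 i j)
  -- Stabilization is assumed only for this `x₀`, so `momentStep` itself need not be stable; its
  -- orbit at the initial moment does tend to zero.
  obtain ⟨s, hs⟩ := exists_tendsto_sum_pow_apply (momentStep A B K q) (initialMoment μ x₀)
    (by simpa only [(hpow _).2] using hlim)
  have hsum : Summable fun t => (initialMoment μ (feedbackState A B x₀ lam K t)).trace := by
    refine (hasSum_iff_tendsto_nat_of_nonneg htr0 s.trace).2 ?_ |>.summable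
    have h := ((continuous_id.matrix_trace).tendsto s).comp hs
    simpa [Function.comp_def, trace_sum, (hpow _).2] using h
  have hnorm : ∀ i j, Summable fun t => ∫ ω, ‖feedbackState A B x₀ lam K t ω i
      * feedbackState A B x₀ lam K t ω j‖ ∂μ := fun i j =>
    hsum.of_nonneg_of_le (fun t => integral_nonneg fun ω => norm_nonneg _)
      fun t => integral_norm_mul_le_trace (hpow t).1 i j
  refine ⟨fun i j => ?_, hlim, ?_⟩
  -- A finite sum of `L¹` norms gives absolute convergence almost everywhere and an integrable
  -- limit.
  · have hfin : ∑' t, ∫⁻ ω, ‖feedbackState A B x₀ lam K t ω i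
        * feedbackState A B x₀ lam K t ω j‖ₑ ∂μ ≠ ⊤ := by
      have h : ∀ t, ∫⁻ ω, ‖feedbackState A B x₀ lam K t ω i
          * feedbackState A B x₀ lam K t ω j‖ₑ ∂μ = ENNReal.ofReal
            (∫ ω, ‖feedbackState A B x₀ lam K t ω i * feedbackState A B x₀ lam K t ω j‖ ∂μ) :=
        fun t => (ofReal_integral_norm_eq_lintegral_enorm ((hpow t).1 i j)).symm
      simp only [h]
      rw [← ENNReal.ofReal_tsum_of_nonneg (fun t => integral_nonneg fun ω => norm_nonneg _)
        (hnorm i j)]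
      exact ENNReal.ofReal_ne_top
    have hmeas : ∀ t, AEStronglyMeasurable (fun ω => feedbackState A B x₀ lam K t ω i
        * feedbackState A B x₀ lam K t ω j) μ := fun t => ((hpow t).1 i j).1
    have hlint : ∫⁻ ω, ∑' t, ‖feedbackState A B x₀ lam K t ω i
        * feedbackState A B x₀ lam K t ω j‖ₑ ∂μ ≠ ⊤ := by
      rwa [lintegral_tsum fun t => (hmeas t).enorm]
    have hae : ∀ᵐ ω ∂μ, Summable fun t =>
        ‖feedbackState A B x₀ lam K t ω i * feedbackState A B x₀ lam K t ω j‖ := by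
      filter_upwards [ae_lt_top' (AEMeasurable.tsum fun t => (hmeas t).enorm) hlint]
        with ω hω
      exact tsum_enorm_ne_top_iff_summable_norm.1 hω.ne
    refine ⟨hae.mono fun ω h => h.of_norm, ?_, ?_⟩
    · refine aestronglyMeasurable_of_tendsto_ae atTop
        (f := fun N ω => ∑ t ∈ Finset.range N, feedbackState A B x₀ lam K t ω i
          * feedbackState A B x₀ lam K t ω j)
        (fun N => Finset.aestronglyMeasurable_fun_sum _ fun t _ => hmeas t) ?_
      exact hae.mono fun ω h => h.of_norm.hasSum.tendsto_sum_nat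
    · exact lt_of_le_of_lt (lintegral_mono fun ω => enorm_tsum_le_tsum_enorm)
        (lt_top_iff_ne_top.2 hlint)
  · refine Pi.hasSum.2 fun i => Pi.hasSum.2 fun j => ?_
    exact hasSum_integral_of_summable_integral_norm (fun t => (hpow t).1 i j) (hnorm i j)

end Moments

/-! ### Cost of certainty-equivalence controllers. -/

section Gap

variable {n m : ℕ} {Ω : Type*} [mΩ : MeasurableSpace Ω] {μ : Measure Ω} [IsProbabilityMeasure μ]
  {q : ℝ} {lam : ℕ → Ω → ℝ} {x₀ : Ω → Fin n → ℝ}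
  {A : Matrix (Fin n) (Fin n) ℝ} {B : Matrix (Fin n) (Fin m) ℝ}
  {Q : Matrix (Fin n) (Fin n) ℝ} {R : Matrix (Fin m) (Fin m) ℝ} {K : Matrix (Fin m) (Fin n) ℝ}

/-- For fixed `y`, the map `M ↦ yᵀMy` is additive and continuous, so it passes through the
convergent sum of semidefinite moments. -/
theorem IsDropSequence.posSemidef_momentSum (hlam : IsDropSequence μ q lam)
    (hq : q ∈ Set.Ioo (0 : ℝ) 1) (hx₀ : Measurable x₀)
    (hindep : IndepFun x₀ (fun ω t => lam t ω) μ)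
    (hx : ∀ i j, Integrable (fun ω => x₀ ω i * x₀ ω j) μ)
    (hK : MeanSquareStabilizes μ A B x₀ lam K) : (momentSum μ A B x₀ lam K).PosSemidef := by
  refine .of_dotProduct_mulVec_nonneg ?_ fun y => ?_
  · ext i j
    simp [momentSum, mul_comm]
  · have hsum := (hlam.hasSum_moment hq hx₀ hindep hx hK).2.2
    let f : Matrix (Fin n) (Fin n) ℝ →+ ℝ :=
      { toFun := fun M => star y ⬝ᵥ (M *ᵥ y)
        map_zero' := by simp
        map_add' := fun M N => by rw [add_mulVec, dotProduct_add] }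
    have hf : Continuous f := by
      change Continuous fun M : Matrix (Fin n) (Fin n) ℝ => star y ⬝ᵥ (M *ᵥ y)
      fun_prop
    exact (hsum.map f hf).nonneg fun t => (posSemidef_initialMoment
      (hlam.moment_eq_pow hq hx₀ hindep hx t).1).dotProduct_mulVec_nonneg y

theorem stepValue_nonneg (hQ : Q.PosDef) (hR : R.PosDef) {p : ℝ} (hp : p ∈ Set.Icc (0 : ℝ) 1)
    {Y : Matrix (Fin n) (Fin n) ℝ} (hY : Y.PosSemidef) (x : Fin n → ℝ) (u : Fin m → ℝ) :
    0 ≤ stepValue A B Q R p Y x u := by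
  have hp1 : 0 ≤ 1 - p := sub_nonneg.2 hp.2
  have hp0 := hp.1
  have h1 := quad_nonneg hQ.posSemidef x
  have h2 := quad_nonneg hR.posSemidef u
  have h3 := quad_nonneg hY (A *ᵥ x)
  have h4 := quad_nonneg hY (A *ᵥ x + B *ᵥ u)
  unfold stepValue
  positivity

/-- The expected stage cost of a certainty-equivalence controller. -/
theorem IsDropSequence.stageCost_gain (hlam : IsDropSequence μ q lam)
    (hq : q ∈ Set.Ioo (0 : ℝ) 1) (hx₀ : Measurable x₀)
    (hindep : IndepFun x₀ (fun ω t => lam t ω) μ) (hQ : Q.PosDef) (hR : R.PosDef)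
    (hx : ∀ i j, Integrable (fun ω => x₀ ω i * x₀ ω j) μ) {p : ℝ}
    {P : Matrix (Fin n) (Fin n) ℝ} (hP : IsRiccatiSolution A B Q R p P) (t : ℕ)
    {M : ℕ → Matrix (Fin n) (Fin n) ℝ}
    (hM : ∀ t, M t = initialMoment μ (feedbackState A B x₀ lam (gain A B R P) t)) :
    0 ≤ (P * M t).trace - (P * M (t + 1)).trace + (q - p) * (gapWeight A B R P * M t).trace ∧
    stageCost μ A B Q R x₀ lam (feedbackControl A B x₀ lam (gain A B R P)) t = ENNReal.ofReal
      ((P * M t).trace - (P * M (t + 1)).trace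
        + (q - p) * (gapWeight A B R P * M t).trace) := by
  have hint := fun t => (hlam.moment_eq_pow (A := A) (B := B) (K := gain A B R P) hq hx₀ hindep
    hx t).1
  have h := hlam.stageCost_add (A := A) (B := B) hq hx₀ hindep hQ hR
    (admissible_feedbackControl (A := A) (B := B) (gain A B R P)) hP.posDef.posSemidef t
  simp only [state_feedbackControl] at h
  rw [lintegral_quad (hint (t + 1)) hP.posDef.posSemidef, ← hM] at h
  have hstep : ∀ ω, stepValue A B Q R q P (feedbackState A B x₀ lam (gain A B R P) t ω)
      (feedbackControl A B x₀ lam (gain A B R P) t ω)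
      = quad (P + (q - p) • gapWeight A B R P)
        (feedbackState A B x₀ lam (gain A B R P) t ω) := fun ω => by
    rw [feedbackControl, hP.stepValue_gain_eq hR, quad_add_matrix, quad_smul_matrix]
  -- Since `q - p` may be negative, nonnegativity is not visible from the matrix; it comes from
  -- reading the form as a `stepValue`.
  have hnn : ∀ ω, 0 ≤ quad (P + (q - p) • gapWeight A B R P)
      (feedbackState A B x₀ lam (gain A B R P) t ω) := fun ω => by
    rw [← hstep]
    exact stepValue_nonneg hQ hR ⟨hq.1.le, hq.2.le⟩ hP.posDef.posSemidef _ _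
  obtain ⟨hi, he⟩ := integral_quad (hint t) (P + (q - p) • gapWeight A B R P)
  have htr : ((P + (q - p) • gapWeight A B R P) * M t).trace
      = (P * M t).trace + (q - p) * (gapWeight A B R P * M t).trace := by
    rw [Matrix.add_mul, trace_add, Matrix.smul_mul, trace_smul, smul_eq_mul]
  rw [← hM, htr] at he
  have h0 : 0 ≤ (P * M t).trace + (q - p) * (gapWeight A B R P * M t).trace :=
    he ▸ integral_nonneg hnn
  have h1 : 0 ≤ (P * M (t + 1)).trace := by
    have := (integral_quad (hint (t + 1)) P).2
    rw [← hM] at this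
    exact this ▸ integral_nonneg fun ω => quad_nonneg hP.posDef.posSemidef _
  simp only [hstep] at h
  rw [← ofReal_integral_eq_lintegral_ofReal hi (ae_of_all _ hnn), he] at h
  -- The identity in `[0, ∞]` itself yields the inequality that makes the stage cost a nonnegative
  -- real difference.
  have hle := (ENNReal.ofReal_le_ofReal_iff h0).1 (h ▸ le_add_self)
  refine ⟨by linarith, ?_⟩
  rw [ENNReal.eq_sub_of_add_eq ENNReal.ofReal_ne_top h, ← ENNReal.ofReal_sub _ h1]
  congr 1
  ring

/-- The cost of a stabilizing certainty-equivalence controller. -/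
theorem IsDropSequence.cost_gain (hlam : IsDropSequence μ q lam)
    (hq : q ∈ Set.Ioo (0 : ℝ) 1) (hx₀ : Measurable x₀)
    (hindep : IndepFun x₀ (fun ω t => lam t ω) μ) (hQ : Q.PosDef) (hR : R.PosDef)
    (hx : ∀ i j, Integrable (fun ω => x₀ ω i * x₀ ω j) μ) {p : ℝ}
    {P : Matrix (Fin n) (Fin n) ℝ} (hP : IsRiccatiSolution A B Q R p P)
    (hK : MeanSquareStabilizes μ A B x₀ lam (gain A B R P)) :
    cost μ A B Q R x₀ lam (feedbackControl A B x₀ lam (gain A B R P)) ≠ ⊤ ∧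
    (cost μ A B Q R x₀ lam (feedbackControl A B x₀ lam (gain A B R P))).toReal
      = (P * initialMoment μ x₀).trace
        + (q - p) * (gapWeight A B R P * momentSum μ A B x₀ lam (gain A B R P)).trace := by
  set M : ℕ → Matrix (Fin n) (Fin n) ℝ :=
    fun t => initialMoment μ (feedbackState A B x₀ lam (gain A B R P) t) with hM
  have hstage := fun t => hlam.stageCost_gain hq hx₀ hindep hQ hR hx hP t (M := M) fun _ => rfl
  obtain ⟨-, hlim, hsum⟩ := hlam.hasSum_moment hq hx₀ hindep hx hK
  have hPlim : Tendsto (fun t => (P * M t).trace) atTop (𝓝 0) := by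
    have hc : Continuous fun N : Matrix (Fin n) (Fin n) ℝ => (P * N).trace :=
      (continuous_const.matrix_mul continuous_id).matrix_trace
    have h := (hc.tendsto 0).comp hlim
    rw [Matrix.mul_zero, trace_zero] at h
    exact h
  have hWlim : Tendsto (fun N => ∑ t ∈ Finset.range N, (gapWeight A B R P * M t).trace) atTop
      (𝓝 (gapWeight A B R P * momentSum μ A B x₀ lam (gain A B R P)).trace) := by
    have hc : Continuous fun N : Matrix (Fin n) (Fin n) ℝ => (gapWeight A B R P * N).trace :=
      (continuous_const.matrix_mul continuous_id).matrix_trace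
    have h := (hc.tendsto _).comp hsum.tendsto_sum_nat
    refine h.congr fun N => ?_
    rw [Function.comp_apply, Matrix.mul_sum, trace_sum]
  have hD : HasSum (fun t => (P * M t).trace - (P * M (t + 1)).trace
      + (q - p) * (gapWeight A B R P * M t).trace)
      ((P * initialMoment μ x₀).trace
        + (q - p) * (gapWeight A B R P * momentSum μ A B x₀ lam (gain A B R P)).trace) := by
    rw [hasSum_iff_tendsto_nat_of_nonneg fun t => (hstage t).1]
    have h := (hPlim.const_sub (P * M 0).trace).add (hWlim.const_mul (q - p))
    rw [sub_zero] at h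
    refine h.congr fun N => ?_
    rw [Finset.sum_add_distrib, Finset.sum_range_sub', Finset.mul_sum]
  have hcost : cost μ A B Q R x₀ lam (feedbackControl A B x₀ lam (gain A B R P))
      = ENNReal.ofReal ((P * initialMoment μ x₀).trace
        + (q - p) * (gapWeight A B R P * momentSum μ A B x₀ lam (gain A B R P)).trace) := by
    rw [hlam.cost_eq_tsum hx₀ (admissible_feedbackControl _), ← hD.tsum_eq,
      ENNReal.ofReal_tsum_of_nonneg (fun t => (hstage t).1) hD.summable]
    exact tsum_congr fun t => (hstage t).2
  rw [hcost]
  exact ⟨ENNReal.ofReal_ne_top, ENNReal.toReal_ofReal (hD.nonneg fun t => (hstage t).1)⟩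

/-- Near the true drop probability, the cost of a certainty-equivalence controller is at most a
factor close to one times the value of the true Riccati solution. -/
theorem IsDropSequence.cost_gain_le (hlam : IsDropSequence μ q lam)
    (hq : q ∈ Set.Ioo (0 : ℝ) 1) (hx₀ : Measurable x₀)
    (hindep : IndepFun x₀ (fun ω t => lam t ω) μ) (hQ : Q.PosDef) (hR : R.PosDef)
    {P : Matrix (Fin n) (Fin n) ℝ} (hP : IsRiccatiSolution A B Q R q P) {c : ℝ} (hc : 0 < c)
    (hPc : ∀ x, quad P (A *ᵥ x) ≤ c * quad Q x) {p : ℝ} (hp : p ∈ Set.Icc (0 : ℝ) 1)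
    (hpq : 2 * (|p - q| * c) < 1) {P' : Matrix (Fin n) (Fin n) ℝ}
    (hP' : IsRiccatiSolution A B Q R p P') :
    cost μ A B Q R x₀ lam (feedbackControl A B x₀ lam (gain A B R P'))
      ≤ ENNReal.ofReal (1 - 2 * (|p - q| * c))⁻¹ * ∫⁻ ω, ENNReal.ofReal (quad P (x₀ ω)) ∂μ := by
  set ε := |p - q| * c with hε
  have hε0 : 0 ≤ ε := by positivity
  have h1ε : 0 < 1 - ε := by linarith
  have h2ε : 0 < 1 - 2 * ε := by linarith
  have hW0 : ∀ {S : Matrix (Fin n) (Fin n) ℝ}, S.PosDef → ∀ x, 0 ≤ quad (gapWeight A B R S) x :=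
    fun hS => quad_nonneg (posSemidef_gapWeight hR hS)
  -- First use of the rescaling: under probability `p` the gain of `P` raises `P` by `(p - q)W ≤ |p
  -- - q| P(A·) ≤ εQ`, so `P/(1 - ε)` dominates `P'`.
  have hPY : ∀ x, quad P' x ≤ (1 - ε)⁻¹ * quad P x := fun x => by
    rw [← quad_smul_matrix]
    refine hP'.quad_le_of_stepValue_le hR hQ hp (hP.posDef.smul (inv_pos.2 h1ε))
      (stepValue_smul_le_of_le hR hp.2 hε0 (by linarith) (K := gain A B R P) fun y => ?_) x
    rw [hP.stepValue_gain_eq hR]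
    have h1 : (p - q) * quad (gapWeight A B R P) y ≤ |p - q| * quad (gapWeight A B R P) y :=
      mul_le_mul_of_nonneg_right (le_abs_self _) (hW0 hP.posDef y)
    have h2 := mul_le_mul_of_nonneg_left ((quad_gapWeight_le (B := B) hR hP.posDef y).trans (hPc y))
      (abs_nonneg (p - q))
    rw [hε]
    linarith
  -- Second use: under the true `q` the gain of `P'` raises `P'` by at most `|p - q| P'(A·) ≤ δQ`,
  -- by the bound just obtained. The two factors combine since `(1 - δ)(1 - ε) = 1 - 2ε`, and `δ <
  -- 1` is exactly `2ε < 1`.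
  set δ := (1 - ε)⁻¹ * ε with hδ
  have hδ0 : 0 ≤ δ := by positivity
  have hδ1 : δ < 1 := by
    rw [hδ, inv_mul_lt_iff₀ h1ε]; linarith
  have hfac : (1 - δ)⁻¹ * (1 - ε)⁻¹ = (1 - 2 * ε)⁻¹ := by
    rw [← mul_inv, hδ]
    congr 1
    field_simp
    ring
  have hcost := hlam.cost_feedback_le (μ := μ) (x₀ := x₀) hq hx₀ hindep hQ hR
    (hP'.posDef.smul (inv_pos.2 (sub_pos.2 hδ1))).posSemidef (K := gain A B R P')
    (stepValue_smul_le_of_le hR hq.2.le hδ0 hδ1 fun y => by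
      rw [hP'.stepValue_gain_eq hR]
      have h1 : (q - p) * quad (gapWeight A B R P') y
          ≤ |p - q| * quad (gapWeight A B R P') y := by
        rw [abs_sub_comm]
        exact mul_le_mul_of_nonneg_right (le_abs_self _) (hW0 hP'.posDef y)
      have h2 : quad (gapWeight A B R P') y ≤ (1 - ε)⁻¹ * (c * quad Q y) :=
        ((quad_gapWeight_le hR hP'.posDef y).trans (hPY _)).trans
          (mul_le_mul_of_nonneg_left (hPc y) (inv_pos.2 h1ε).le)
      have h3 := mul_le_mul_of_nonneg_left h2 (abs_nonneg (p - q))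
      have h4 : |p - q| * ((1 - ε)⁻¹ * (c * quad Q y)) = δ * quad Q y := by
        rw [hδ, hε]; ring
      linarith)
  refine hcost.trans ?_
  rw [← lintegral_const_mul' _ _ ENNReal.ofReal_ne_top]
  refine lintegral_mono fun ω => ?_
  rw [← ENNReal.ofReal_mul (inv_pos.2 h2ε).le]
  refine ENNReal.ofReal_le_ofReal ?_
  rw [quad_smul_matrix, ← hfac, mul_assoc]
  exact mul_le_mul_of_nonneg_left (hPY _) (inv_pos.2 (sub_pos.2 hδ1)).le

theorem criticalProb_le_one : criticalProb A B Q R ≤ 1 :=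
  Real.sSup_le (fun _ hp => hp.1.2) zero_le_one

end Gap

end PacketDropLQR

/-! ### The gap formula and its limit. -/

theorem theorem8 {n m : ℕ} {Ω : Type*} [MeasurableSpace Ω] (μ : Measure Ω)
    [IsProbabilityMeasure μ]
    (A : Matrix (Fin n) (Fin n) ℝ) (B : Matrix (Fin n) (Fin m) ℝ)
    (Q : Matrix (Fin n) (Fin n) ℝ) (R : Matrix (Fin m) (Fin m) ℝ)
    (hQ : Q.PosDef) (hR : R.PosDef)
    (q : ℝ) (hq : q ∈ Set.Ioo (0 : ℝ) 1) (hqc : q < criticalProb A B Q R)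
    (lam : ℕ → Ω → ℝ) (hlam : IsDropSequence μ q lam)
    (x₀ : Ω → Fin n → ℝ) (hx₀ : Measurable x₀) (hx₀2 : ∀ i, MemLp (fun ω => x₀ ω i) 2 μ)
    (hindep : IndepFun x₀ (fun ω t => lam t ω) μ)
    (P : Matrix (Fin n) (Fin n) ℝ) (hP : IsRiccatiSolution A B Q R q P) :
    -- the optimal cost is finite and the initial second moment is positive semidefinite
    optimalCost μ A B Q R x₀ lam ≠ ⊤ ∧ (initialMoment μ x₀).PosSemidef ∧
    -- the gap formula for every stabilizing certainty-equivalence controller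
    (∀ qhat ∈ Set.Ico 0 (criticalProb A B Q R), ∀ Phat : Matrix (Fin n) (Fin n) ℝ,
      IsRiccatiSolution A B Q R qhat Phat →
      MeanSquareStabilizes μ A B x₀ lam (gain A B R Phat) →
      MomentSumFinite μ A B x₀ lam (gain A B R Phat) ∧
      (gapWeight A B R Phat).PosSemidef ∧
      (momentSum μ A B x₀ lam (gain A B R Phat)).PosSemidef ∧
      cost μ A B Q R x₀ lam (feedbackControl A B x₀ lam (gain A B R Phat)) ≠ ⊤ ∧
      (cost μ A B Q R x₀ lam (feedbackControl A B x₀ lam (gain A B R Phat))).toReal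
          - (optimalCost μ A B Q R x₀ lam).toReal
        = ((q - qhat) • (gapWeight A B R Phat * momentSum μ A B x₀ lam (gain A B R Phat))
            + (Phat - P) * initialMoment μ x₀).trace) ∧
    -- the gap tends to zero as the estimate tends to the true drop probability
    (∀ Phat : ℝ → Matrix (Fin n) (Fin n) ℝ,
      (∀ qhat ∈ Set.Ico 0 (criticalProb A B Q R),
        IsRiccatiSolution A B Q R qhat (Phat qhat)) →
      (∀ᶠ qhat in 𝓝 q,
        MeanSquareStabilizes μ A B x₀ lam (gain A B R (Phat qhat)) ∧
        cost μ A B Q R x₀ lam (feedbackControl A B x₀ lam (gain A B R (Phat qhat))) ≠ ⊤) ∧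
      Tendsto (fun qhat =>
          (cost μ A B Q R x₀ lam (feedbackControl A B x₀ lam (gain A B R (Phat qhat)))).toReal
            - (optimalCost μ A B Q R x₀ lam).toReal)
        (𝓝 q) (𝓝 0)) := by
  have hx : ∀ i j, Integrable (fun ω => x₀ ω i * x₀ ω j) μ :=
    fun i j => (hx₀2 i).integrable_mul (hx₀2 j)
  have hopt := hlam.optimalCost_eq (μ := μ) (x₀ := x₀) hq hx₀ hindep hQ hR hP
  have hoptr := hopt.trans (lintegral_quad hx hP.posDef.posSemidef)
  have hfin : optimalCost μ A B Q R x₀ lam ≠ ⊤ := hoptr ▸ ENNReal.ofReal_ne_top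
  have hX₀ := posSemidef_initialMoment hx
  refine ⟨hfin, hX₀, fun qhat _ Phat hPhat hK => ?_, fun Phat hPhat => ?_⟩
  · have hcost := hlam.cost_gain hq hx₀ hindep hQ hR hx hPhat hK
    refine ⟨(hlam.hasSum_moment hq hx₀ hindep hx hK).1, posSemidef_gapWeight hR hPhat.posDef,
      hlam.posSemidef_momentSum hq hx₀ hindep hx hK, hcost.1, ?_⟩
    have hnn : 0 ≤ (P * initialMoment μ x₀).trace := by
      rw [← (integral_quad hx P).2]
      exact integral_nonneg fun ω => quad_nonneg hP.posDef.posSemidef _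
    rw [hcost.2, hoptr, ENNReal.toReal_ofReal hnn, trace_add, trace_smul, smul_eq_mul,
      Matrix.sub_mul, trace_sub]
    ring
  -- The constant `c` depends only on the true `P`, so the bound on the cost is uniform in `qhat`.
  · obtain ⟨c, hc, hPc⟩ := exists_quad_le_mul_quad hQ (Aᵀ * P * A)
    simp only [quad_transpose_mul_mul] at hPc
    have hsmall : Tendsto (fun qhat : ℝ => 2 * (|qhat - q| * c)) (𝓝 q) (𝓝 0) := by
      have h : Continuous fun qhat : ℝ => 2 * (|qhat - q| * c) := by fun_prop
      simpa using h.tendsto q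
    have hbound : ∀ᶠ qhat in 𝓝 q,
        cost μ A B Q R x₀ lam (feedbackControl A B x₀ lam (gain A B R (Phat qhat)))
          ≤ ENNReal.ofReal (1 - 2 * (|qhat - q| * c))⁻¹ * optimalCost μ A B Q R x₀ lam := by
      -- The interval from `0` to the critical probability is a neighbourhood of `q` on which `Phat`
      -- is known to solve its Riccati equation.
      filter_upwards [Ioo_mem_nhds hq.1 hqc, hsmall.eventually_lt_const one_pos]
        with qhat hmem hlt
      rw [hopt]
      exact hlam.cost_gain_le hq hx₀ hindep hQ hR hP hc hPc
        ⟨hmem.1.le, hmem.2.le.trans criticalProb_le_one⟩ hlt (hPhat qhat ⟨hmem.1.le, hmem.2⟩)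
    have hcfin : ∀ᶠ qhat in 𝓝 q,
        cost μ A B Q R x₀ lam (feedbackControl A B x₀ lam (gain A B R (Phat qhat))) ≠ ⊤ :=
      hbound.mono fun qhat h => ne_top_of_le_ne_top (ENNReal.mul_ne_top ENNReal.ofReal_ne_top hfin) h
    refine ⟨hcfin.mono fun qhat h => ⟨hlam.meanSquareStabilizes hq hx₀ hQ hR h, h⟩, ?_⟩
    have hupper : Tendsto (fun qhat => (1 - 2 * (|qhat - q| * c))⁻¹
        * (optimalCost μ A B Q R x₀ lam).toReal - (optimalCost μ A B Q R x₀ lam).toReal)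
        (𝓝 q) (𝓝 0) := by
      have h := (((hsmall.const_sub 1).inv₀ (by norm_num)).mul_const
        (optimalCost μ A B Q R x₀ lam).toReal).sub_const (optimalCost μ A B Q R x₀ lam).toReal
      simpa using h
    refine tendsto_of_tendsto_of_tendsto_of_le_of_le' tendsto_const_nhds hupper ?_ ?_
    · filter_upwards [hcfin] with qhat h
      exact sub_nonneg.2 (ENNReal.toReal_mono h
        (iInf₂_le _ (admissible_feedbackControl (gain A B R (Phat qhat)))))
    · filter_upwards [hbound, hsmall.eventually_lt_const one_pos] with qhat h hlt
      have h1 := ENNReal.toReal_mono (ENNReal.mul_ne_top ENNReal.ofReal_ne_top hfin) h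
      rw [ENNReal.toReal_mul, ENNReal.toReal_ofReal (inv_pos.2 (sub_pos.2 hlt)).le] at h1
      exact sub_le_sub_right h1 _
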